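/- Let $\Omega\subset\mathbb R^d$ be compact, let $\mu_0$ be a Borel probability measure on $\mathbb R^d$ with $\mu_0(\Omega)=1$, let $\nu$ be a Borel probability measure on $\mathbb R^d$, and let $\beta>0$. Let $\mathcal B_{TV}=\mathcal M(\Omega,\mathbb R^d)$ be the space of $\mathbb R^d$-valued Borel measures on $\Omega$, with the total variation norm $$|\Gamma|_{TV}=\sup\Big\{\int_\Omega \langle f,d\Gamma\rangle \;:\; f\in C^0(\Omega,\mathbb R^d),\ \sup_{z\in\Omega}|f(z)|\le 1\Big\},$$ and let $L^2([0,1],\mathcal B_{TV})$ be the space of weak-* measurable curves $\Gamma=(\Gamma_t)_{t\in[0,1]}$ in $\mathcal B_{TV}$ (i.e. $t\mapsto\int_\Omega\langle f,d\Gamma_t\rangle$ is Lebesgue measurable for each $f\in C^0(\Omega,\mathbb R^d)$) such that $\int_0^1|\Gamma_t|_{TV}^2\,dt<\infty$. Let $K(x,y)=-|x-y|$ be the Energy-Distance kernel and, for $\Gamma\in L^2([0,1],\mathcal B_{TV})$, let $$v_t(x)=(K\star\Gamma_t)(x)=-\int_\Omega |x-z|\,d\Gamma_t(z)\qquad(x\in\mathbb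 R^d).$$ Let $\mathcal L(\cdot,\cdot)$ be a loss on pairs of Borel probability measures on $\mathbb R^d$, with values in $[0,\infty]$, such that for every compact $C\subset\mathbb R^d$ the map $\mu\mapsto\mathcal L(\mu,\nu)$ is lower semicontinuous, for the weak-* topology, on the set of probability measures carried by $C$. Then: 1. For every $\Gamma\in L^2([0,1],\mathcal B_{TV})$ there is a unique flow $\psi_\Gamma$ of $v$ on $[0,1]$, that is, a unique family of maps $\psi_\Gamma(t):\mathbb R^d\to\mathbb R^d$, $t\in[0,1]$, such that for every $x$ the curve $t\mapsto\psi_\Gamma(t)(x)$ is continuous, $s\mapsto v_s(\psi_\Gamma(s)(x))$ is integrable on $[0,1]$, and $$\psi_\Gamma(t)(x)=x+\int_0^t v_s(\psi_\Gamma(s)(x))\,ds\qquad(t\in[0,1]);$$ moreover $\psi_\Gamma(1)$ is continuous. 2. The functional $$E^\beta(\Gamma)=\mathcal L\big(\psi_\Gamma(1)_\#\mu_0,\nu\big)+\beta\int_0^1|\Gamma_t|_{TV}^2\,dt$$ attains its minimum over $L^2([0,1],\mathcal B_{TV})$. 3. For every minimizer $\Gamma$ of $E^\beta$, the optimal map $\psi_\Gamma(1)$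 is a bi-Lipschitz homeomorphism of $\mathbb R^d$ onto itself. -/

import Mathlib

open MeasureTheory Set
open scoped ENNReal

noncomputable section

namespace TVMatching

/-- Euclidean space `ℝᵈ`. -/
abbrev Euc (d : ℕ) : Type := EuclideanSpace ℝ (Fin d)

/-- The space `𝓜(Ω, ℝᵈ)` of `ℝᵈ`-valued (countably additive) Borel measures on `Ω ⊆ ℝᵈ`. -/
abbrev VecMeas {d : ℕ} (Ω : Set (Euc d)) : Type := VectorMeasure Ω (Euc d)

/-- Every `ℝᵈ`-valued measure has finite variation. Hence bounded continuous functions are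
integrable with respect to it, so that the integrals below are genuine ones. -/
theorem variation_univ_lt_top {d : ℕ} {Ω : Set (Euc d)} (Γ : VecMeas Ω) :
    Γ.variation univ < ∞ := by
  let p : Fin d → Euc d →+ ℝ := fun i => (EuclideanSpace.proj (𝕜 := ℝ) i).toLinearMap.toAddMonoidHom
  have hp : ∀ i, Continuous (p i) := fun i => (EuclideanSpace.proj (𝕜 := ℝ) i).continuous
  let s : Fin d → SignedMeasure Ω := fun i => Γ.mapRange (p i) (hp i)
  let m : Measure Ω := Measure.sum fun i => (s i).totalVariation
  have hle : Γ.variation ≤ m := by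
    apply VectorMeasure.variation_le_of_forall_enorm_le
    intro A hA
    have h1 : ‖Γ A‖ₑ ≤ ∑ i, ‖s i A‖ₑ := by
      have h2 : Γ A = ∑ i, EuclideanSpace.single i (Γ A i) := by
        ext j
        simp [Finset.sum_apply]
      calc ‖Γ A‖ₑ = ‖∑ i, EuclideanSpace.single i (Γ A i)‖ₑ := by rw [← h2]
        _ ≤ ∑ i, ‖EuclideanSpace.single i (Γ A i)‖ₑ := enorm_sum_le _ _
        _ = ∑ i, ‖s i A‖ₑ := by
          refine Finset.sum_congr rfl fun i _ => ?_
          simp only [← ofReal_norm, PiLp.norm_single]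
          rfl
    refine h1.trans ?_
    rw [Measure.sum_apply _ hA, tsum_fintype]
    exact Finset.sum_le_sum fun i _ => SignedMeasure.enorm_le_totalVariation (s i) A
  have hm : m univ < ∞ := by
    rw [Measure.sum_apply _ MeasurableSet.univ, tsum_fintype]
    refine ENNReal.sum_lt_top.2 fun i _ => ?_
    rw [SignedMeasure.totalVariation]
    exact measure_lt_top _ _
  exact (hle univ).trans_lt hm

/-- The duality pairing `⟨Γ, f⟩ = ∫_Ω ⟨f(z), dΓ(z)⟩` between vector measures and vector fields. -/
def pairing {d : ℕ} {Ω : Set (Euc d)} (Γ : VecMeas Ω) (f : Ω → Euc d) : ℝ :=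
  VectorMeasure.integral Γ f (innerSL ℝ)

/-- The total variation norm, by duality with continuous vector fields for the sup norm:
`|Γ|_TV = sup {⟨Γ, f⟩ : f ∈ C⁰(Ω, ℝᵈ), sup_z |f(z)| ≤ 1}`. -/
def tvNorm {d : ℕ} {Ω : Set (Euc d)} (Γ : VecMeas Ω) : ℝ≥0∞ :=
  ⨆ (f : C(Ω, Euc d)) (_ : ∀ z, ‖f z‖ ≤ 1), ENNReal.ofReal (pairing Γ f)

/-- The Energy-Distance kernel `K(x, y) = -|x - y|`. -/
def edKernel {d : ℕ} (x y : Euc d) : ℝ := -‖x - y‖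

/-- The vector field `K ⋆ Γ` on `ℝᵈ`, `(K ⋆ Γ)(x) = ∫_Ω K(x, z) dΓ(z)`. -/
def conv {d : ℕ} {Ω : Set (Euc d)} (Γ : VecMeas Ω) (x : Euc d) : Euc d :=
  VectorMeasure.integral Γ (fun z : Ω => edKernel x z) (ContinuousLinearMap.lsmul ℝ ℝ)

/-- Elements of `L²([0,1], 𝓑_TV)`: weak-* measurable curves `t ↦ Γ_t` of vector measures on `Ω` with
`∫₀¹ |Γ_t|²_TV dt < ∞`. This is the dual of `L²([0,1], C⁰(Ω, ℝᵈ))`; only the values of the curve at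
almost every `t ∈ [0,1]` matter. -/
structure L2Curve {d : ℕ} (Ω : Set (Euc d)) where
  /-- The measure `Γ_t`. -/
  toFun : ℝ → VecMeas Ω
  weakStar_measurable : ∀ f : C(Ω, Euc d),
    AEMeasurable (fun t => pairing (toFun t) f) (volume.restrict (Icc (0 : ℝ) 1))
  sq_integrable : ∫⁻ t in Icc (0 : ℝ) 1, tvNorm (toFun t) ^ 2 < ∞

/-- `ψ` is a flow on `[0,1]` of `v_t = K ⋆ Γ_t`, i.e. for every `x ∈ ℝᵈ` the curve `t ↦ ψ_t(x)` is
a (Carathéodory) solution of `∂_t ψ_t(x) = v_t(ψ_t(x))`, `ψ_0(x) = x`. -/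
def IsFlow {d : ℕ} {Ω : Set (Euc d)} (Γ : L2Curve Ω) (ψ : ℝ → Euc d → Euc d) : Prop :=
  ∀ x : Euc d,
    ContinuousOn (fun t => ψ t x) (Icc 0 1) ∧
    IntervalIntegrable (fun s => conv (Γ.toFun s) (ψ s x)) volume 0 1 ∧
    ∀ t ∈ Icc (0 : ℝ) 1, ψ t x = x + ∫ s in (0 : ℝ)..t, conv (Γ.toFun s) (ψ s x)

/-- The flow `ψ_Γ` (its existence and its uniqueness on `[0,1]` are part of the theorem). -/
def flow {d : ℕ} {Ω : Set (Euc d)} (Γ : L2Curve Ω) : ℝ → Euc d → Euc d :=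
  Classical.epsilon (IsFlow Γ)

open Classical in
/-- The push-forward `T_# μ` of a probability measure (with a dummy value if `T` is not measurable,
which is never used for the time-one maps of flows, as these are continuous). -/
def pushforward {d : ℕ} (T : Euc d → Euc d) (μ : ProbabilityMeasure (Euc d)) :
    ProbabilityMeasure (Euc d) :=
  if h : AEMeasurable T (μ : Measure (Euc d)) then μ.map h else μ

/-- The energy `E^β(Γ) = 𝓛(ψ_Γ(1)_# μ₀, ν) + β ∫₀¹ |Γ_t|²_TV dt`. -/
def energy {d : ℕ} {Ω : Set (Euc d)}
    (L : ProbabilityMeasure (Euc d) → ProbabilityMeasure (Euc d) → ℝ≥0∞)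
    (μ₀ ν : ProbabilityMeasure (Euc d)) (β : ℝ) (Γ : L2Curve Ω) : ℝ≥0∞ :=
  L (pushforward (flow Γ 1) μ₀) ν
    + ENNReal.ofReal β * ∫⁻ t in Icc (0 : ℝ) 1, tvNorm (Γ.toFun t) ^ 2

/-- `Γ` minimizes the energy `E^β` over `L²([0,1], 𝓑_TV)`. -/
def IsMinimizer {d : ℕ} {Ω : Set (Euc d)}
    (L : ProbabilityMeasure (Euc d) → ProbabilityMeasure (Euc d) → ℝ≥0∞)
    (μ₀ ν : ProbabilityMeasure (Euc d)) (β : ℝ) (Γ : L2Curve Ω) : Prop :=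
  ∀ Γ' : L2Curve Ω, energy L μ₀ ν β Γ ≤ energy L μ₀ ν β Γ'

/-- `T` is a homeomorphism of `ℝᵈ` onto itself such that `T` and `T⁻¹` are Lipschitz. -/
def IsBiLipschitzHomeo {d : ℕ} (T : Euc d → Euc d) : Prop :=
  ∃ h : Euc d ≃ₜ Euc d, (∀ x, h x = T x) ∧
    (∃ C, LipschitzWith C h) ∧ ∃ C, LipschitzWith C h.symm

/-- For every compact `C ⊆ ℝᵈ`, the functional `F` is lower semicontinuous on the set `𝓟(C)` of
probability measures carried by `C`, for the weak-* topology (the topology of convergence against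
bounded continuous functions). -/
def WeakStarLSC {d : ℕ} (F : ProbabilityMeasure (Euc d) → ℝ≥0∞) : Prop :=
  ∀ C : Set (Euc d), IsCompact C → LowerSemicontinuousOn F {μ | μ C = 1}

end TVMatching

end

/-! The kernel `-|x - z|` is 1-Lipschitz in `x` and bounded by `R + |x|` when `Ω` lies in the ball
of radius `R`. By duality, `K ⋆ Γ_t` is therefore Lipschitz with constant `|Γ_t|_TV` and has linear
growth. This constant is square integrable in time, so Carathéodory theory applies: Picard iteration
gives existence, a Grönwall inequality gives uniqueness and Lipschitz dependence on the initial
point, and reversing time gives a Lipschitz inverse. Hence `ψ_Γ(1)` is bi-Lipschitz for every curve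
`Γ` (`exists_homeomorph`).

Minimizers come from the direct method, with limits taken along a nonprincipal ultrafilter so that
no subsequence is extracted. Along a minimizing sequence, the functions `t ↦ ⟨Γ_t, f⟩` and `t ↦
|Γ_t|_TV` are bounded in `L²([0,1])` and have weak limits `W f` and `b`, with `|W f| ≤ b ‖f‖` almost
everywhere. Lebesgue differentiation turns `W` into a family of functionals on `C(Ω, ℝᵈ)`, the Riesz
theorem turns these into measures, and `‖b‖` bounds the cost of the resulting curve
(`exists_weakStar_limit`).

Weak convergence of the fields at each fixed point of space suffices for convergence of the flows
(`tendsto_integralCurve`), because all fields share one bound on their Lipschitz constants in `L²`.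
The time-one maps are equi-Lipschitz, so they converge uniformly on `Ω`. The push-forwards thus
converge weakly inside a common compact set, where the loss is lower semicontinuous. -/

noncomputable section

namespace TVMatching

open Filter Topology

/-! ### Superposition measurability and Grönwall inequalities -/

section Caratheodory

variable {E : Type*}

/-- Lebesgue measure on the time interval `[0, 1]`. -/
abbrev timeMeasure : Measure ℝ := volume.restrict (Icc (0 : ℝ) 1)

open Classical in
theorem caratheodory_simpleFunc_eq_sum {α : Type*} [MeasurableSpace α] {F : Type*}
    [AddCommMonoid F] (v : α → E → F) (u : SimpleFunc α E) (s : α) :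
    v s (u s) = ∑ c ∈ u.range, (u ⁻¹' {c}).indicator (fun s => v s c) s := by
  rw [Finset.sum_eq_single (u s)]
  · simp
  · intro b _ hb
    simp [Set.indicator, Ne.symm hb]
  · intro h
    exact absurd (u.mem_range_self s) h

theorem aestronglyMeasurable_caratheodory_simpleFunc {α : Type*} [MeasurableSpace α]
    {μ : Measure α} {F : Type*} [NormedAddCommGroup F] {v : α → E → F}
    (hm : ∀ x, AEStronglyMeasurable (fun s => v s x) μ) (u : SimpleFunc α E) :
    AEStronglyMeasurable (fun s => v s (u s)) μ := by
  classical
  simp_rw [caratheodory_simpleFunc_eq_sum v u]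
  exact Finset.aestronglyMeasurable_fun_sum _ fun c _ =>
    (hm c).indicator (u.measurableSet_fiber c)

variable [NormedAddCommGroup E]

/-- Joint measurability of `v` is not assumed: simple functions are inserted for `u`, and continuity
in space passes to the limit. -/
theorem aestronglyMeasurable_caratheodory {α : Type*} [MeasurableSpace α]
    {μ : Measure α} {F : Type*} [NormedAddCommGroup F] {v : α → E → F}
    (hm : ∀ x, AEStronglyMeasurable (fun s => v s x) μ) (hc : ∀ s, Continuous (v s))
    {u : α → E} (hu : AEStronglyMeasurable u μ) :
    AEStronglyMeasurable (fun s => v s (u s)) μ := by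
  have h1 : AEStronglyMeasurable (fun s => v s (hu.mk u s)) μ :=
    aestronglyMeasurable_of_tendsto_ae atTop
      (fun n => aestronglyMeasurable_caratheodory_simpleFunc hm (hu.stronglyMeasurable_mk.approx n))
      (Eventually.of_forall fun s =>
        ((hc s).tendsto _).comp (hu.stronglyMeasurable_mk.tendsto_approx s))
  refine h1.congr ?_
  filter_upwards [hu.ae_eq_mk] with s hs
  rw [hs]

/-- The Cauchy-Schwarz inequality for integrals of real functions. -/
theorem sq_integral_mul_le {α : Type*} [MeasurableSpace α] {μ : Measure α} {f g : α → ℝ}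
    (hf : MemLp f 2 μ) (hg : MemLp g 2 μ) :
    (∫ s, f s * g s ∂μ) ^ 2 ≤ (∫ s, f s ^ 2 ∂μ) * ∫ s, g s ^ 2 ∂μ := by
  have key : ∀ {h k : α → ℝ} (hh : MemLp h 2 μ) (hk : MemLp k 2 μ),
      inner ℝ (hh.toLp h) (hk.toLp k) = ∫ s, h s * k s ∂μ := by
    intro h k hh hk
    rw [L2.inner_def]
    refine integral_congr_ae ?_
    filter_upwards [hh.coeFn_toLp, hk.coeFn_toLp] with s h1 h2
    rw [h1, h2]
    simp [mul_comm]
  have h0 := real_inner_mul_inner_self_le (hf.toLp f) (hg.toLp g)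
  rw [key, key, key] at h0
  simpa [sq] using h0

theorem memLp_two_of_continuousOn {u : ℝ → E} (hu : ContinuousOn u (Icc 0 1)) :
    MemLp u 2 timeMeasure := by
  obtain ⟨C, hC⟩ := isCompact_Icc.exists_bound_of_continuousOn hu
  refine MemLp.of_bound (hu.aestronglyMeasurable_of_isCompact isCompact_Icc measurableSet_Icc) C ?_
  filter_upwards [ae_restrict_mem measurableSet_Icc] with s hs using hC s hs

theorem timeMeasure_restrict_Ioc {s t : ℝ} (hs : 0 ≤ s) (ht : t ≤ 1) :
    timeMeasure.restrict (Ioc s t) = volume.restrict (Ioc s t) := by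
  rw [Measure.restrict_restrict measurableSet_Ioc, inter_eq_left.2]
  exact fun r hr => ⟨hs.trans hr.1.le, hr.2.trans ht⟩

/-- Cauchy-Schwarz trades the `L²` coefficient `a` for the constant `M`, at the price of squaring.
The Grönwall, Picard and Hölder estimates below all rest on this. -/
theorem sq_integral_Ioc_mul_le {a g : ℝ → ℝ} {M s t : ℝ} (ha : MemLp a 2 timeMeasure)
    (hM : ∫ s, a s ^ 2 ∂timeMeasure ≤ M) (hg : ContinuousOn g (Icc 0 1))
    (hs : 0 ≤ s) (hst : s ≤ t) (ht : t ≤ 1) :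
    (∫ r in s..t, a r * g r) ^ 2 ≤ M * ∫ r in s..t, g r ^ 2 := by
  rw [intervalIntegral.integral_of_le hst, intervalIntegral.integral_of_le hst,
    ← timeMeasure_restrict_Ioc hs ht]
  refine (sq_integral_mul_le (ha.restrict _) ((memLp_two_of_continuousOn hg).restrict _)).trans ?_
  gcongr
  exact (setIntegral_le_integral ha.integrable_sq (ae_of_all _ fun _ => sq_nonneg _)).trans hM

theorem ContinuousOn.intervalIntegrable_unit {u : ℝ → E} (hu : ContinuousOn u (Icc 0 1))
    {s t : ℝ} (hs : s ∈ Icc (0 : ℝ) 1) (ht : t ∈ Icc (0 : ℝ) 1) :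
    IntervalIntegrable u volume s t :=
  (hu.mono (uIcc_subset_Icc hs ht)).intervalIntegrable

/-- Since `g` is merely continuous, the differential inequality is applied to its majorant `G`,
which has right derivative `K g ≤ K G`. -/
theorem gronwall_integral {g : ℝ → ℝ} {c K : ℝ} (hK : 0 ≤ K)
    (hg : ContinuousOn g (Icc 0 1))
    (h : ∀ t ∈ Icc (0 : ℝ) 1, g t ≤ c + K * ∫ s in (0 : ℝ)..t, g s) :
    ∀ t ∈ Icc (0 : ℝ) 1, g t ≤ c * Real.exp (K * t) := by
  intro t ht
  let G : ℝ → ℝ := fun t => c + K * ∫ s in (0 : ℝ)..t, g s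
  have hd : ∀ x ∈ Ico (0 : ℝ) 1, HasDerivWithinAt G (K * g x) (Ici x) x := by
    intro x hx
    have h1 : HasDerivWithinAt (fun t => ∫ s in (0 : ℝ)..t, g s) (g x) (Ici x) x := by
      have hcw : ContinuousWithinAt g (Icc x 1) x :=
        (hg x (Ico_subset_Icc_self hx)).mono (Icc_subset_Icc_left hx.1)
      have hcI : ContinuousWithinAt g (Ioi x) x := by
        refine (hcw.mono Ioc_subset_Icc_self).mono_of_mem_nhdsWithin ?_
        exact Ioc_mem_nhdsGT hx.2
      refine intervalIntegral.integral_hasDerivWithinAt_right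
        (ContinuousOn.intervalIntegrable_unit hg ⟨le_rfl, zero_le_one⟩ (Ico_subset_Icc_self hx))
        (t := Ioi x) ?_ hcI
      refine ⟨Icc x 1, mem_of_superset (Ioc_mem_nhdsGT hx.2) Ioc_subset_Icc_self, ?_⟩
      exact ((hg.mono (Icc_subset_Icc_left hx.1)).aestronglyMeasurable_of_isCompact
        isCompact_Icc measurableSet_Icc)
    exact (h1.const_mul K).const_add c
  have hGc : ContinuousOn G (Icc 0 1) := by
    refine continuousOn_const.add (continuousOn_const.mul ?_)
    have := intervalIntegral.continuousOn_primitive_interval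
      (f := g) (μ := volume) (a := 0) (b := 1) (by
        rw [uIcc_of_le zero_le_one]; exact hg.integrableOn_Icc)
    rwa [uIcc_of_le zero_le_one] at this
  have hG := le_gronwallBound_of_liminf_deriv_right_le (f := G) (f' := fun x => K * g x)
    (δ := c) (K := K) (ε := 0) (a := 0) (b := 1) hGc
    (fun x hx r hr => (hd x hx).liminf_right_slope_le hr) (by simp [G])
    (fun x hx => by
      have := h x (Ico_subset_Icc_self hx)
      simp only [G, add_zero]
      gcongr) t ht
  rw [gronwallBound_ε0, sub_zero] at hG
  exact (h t ht).trans hG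

/-- A Grönwall inequality for a square integrable coefficient. -/
theorem gronwall_memLp {a g : ℝ → ℝ} {c M : ℝ} (ha : MemLp a 2 timeMeasure)
    (hM : ∫ s, a s ^ 2 ∂timeMeasure ≤ M) (hc : 0 ≤ c)
    (hg : ContinuousOn g (Icc 0 1)) (hg0 : ∀ t ∈ Icc (0 : ℝ) 1, 0 ≤ g t)
    (h : ∀ t ∈ Icc (0 : ℝ) 1, g t ≤ c + ∫ s in (0 : ℝ)..t, a s * g s) :
    ∀ t ∈ Icc (0 : ℝ) 1, g t ≤ 2 * c * Real.exp M := by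
  intro t ht
  have hM0 : 0 ≤ M := (integral_nonneg fun _ => sq_nonneg _).trans hM
  -- From `(c + I)² ≤ 2c² + 2I²` and `I² ≤ M ∫ g²`, the square of `g` satisfies a Grönwall
  -- inequality with constant rate `2M`. The root gives `√2 c e^M`, rounded up to `2 c e^M`.
  have key : g t ^ 2 ≤ 2 * c ^ 2 * Real.exp (2 * M * t) := by
    refine gronwall_integral (g := fun s => g s ^ 2) (K := 2 * M) (by positivity)
      (hg.pow 2) ?_ t ht
    intro t ht
    have h1 := sq_integral_Ioc_mul_le ha hM hg le_rfl ht.1 ht.2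
    have h2 : g t ^ 2 ≤ (c + ∫ s in (0 : ℝ)..t, a s * g s) ^ 2 :=
      pow_le_pow_left₀ (hg0 t ht) (h t ht) 2
    have h3 := add_sq_le (a := c) (b := ∫ s in (0 : ℝ)..t, a s * g s)
    calc _ ≤ _ := h2
      _ ≤ _ := h3
      _ ≤ 2 * (c ^ 2 + M * ∫ r in (0 : ℝ)..t, g r ^ 2) := by gcongr
      _ = _ := by ring
  have h4 : Real.exp (2 * M * t) ≤ Real.exp M ^ 2 := by
    rw [← Real.exp_nat_mul]
    refine Real.exp_le_exp.2 ?_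
    push_cast
    nlinarith [ht.2]
  refine abs_le_of_sq_le_sq' ?_ (by positivity) |>.2
  calc g t ^ 2 ≤ 2 * c ^ 2 * Real.exp M ^ 2 := key.trans (by gcongr)
    _ ≤ (2 * c * Real.exp M) ^ 2 := by nlinarith [sq_nonneg (c * Real.exp M)]

end Caratheodory

/-! ### Carathéodory flows: existence, uniqueness and inversion -/

section Caratheodory

variable {E : Type*} [NormedAddCommGroup E]

/-- A time-dependent vector field on `[0, 1]`, measurable in time and Lipschitz in space with a
square integrable Lipschitz constant. -/
structure IsCaratheodory (v : ℝ → E → E) (a : ℝ → ℝ) (R : ℝ) : Prop where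
  meas : ∀ x, AEStronglyMeasurable (fun t => v t x) timeMeasure
  lip : ∀ t x y, ‖v t x - v t y‖ ≤ a t * ‖x - y‖
  growth : ∀ t x, ‖v t x‖ ≤ a t * (R + ‖x‖)
  coeff_nonneg : ∀ t, 0 ≤ a t
  radius_nonneg : 0 ≤ R
  memLp : MemLp a 2 timeMeasure

/-- `u` is a Carathéodory solution on `[0, 1]` of `∂_t u = v_t(u)`, `u(0) = x`. -/
def IsIntegralCurveFrom [NormedSpace ℝ E] (v : ℝ → E → E) (x : E) (u : ℝ → E) : Prop :=
  ContinuousOn u (Icc 0 1) ∧ IntervalIntegrable (fun s => v s (u s)) volume 0 1 ∧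
    ∀ t ∈ Icc (0 : ℝ) 1, u t = x + ∫ s in (0 : ℝ)..t, v s (u s)

theorem intervalIntegrable_of_timeMeasure {F : Type*} [NormedAddCommGroup F] {f : ℝ → F}
    (hf : Integrable f timeMeasure) {s t : ℝ} (hs : s ∈ Icc (0 : ℝ) 1) (ht : t ∈ Icc (0 : ℝ) 1) :
    IntervalIntegrable f volume s t := by
  have : IntegrableOn f (Icc 0 1) volume := hf
  exact ((intervalIntegrable_iff_integrableOn_Icc_of_le zero_le_one).2 this).mono_set
    ((uIcc_subset_Icc hs ht).trans Icc_subset_uIcc)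

namespace IsCaratheodory

variable {v w : ℝ → E → E} {a b : ℝ → ℝ} {R M : ℝ} {x y : E} {u p : ℝ → E}

theorem continuous (hv : IsCaratheodory v a R) (t : ℝ) : Continuous (v t) := by
  refine (LipschitzWith.of_dist_le' (K := a t) fun x y => ?_).continuous
  rw [dist_eq_norm, dist_eq_norm]
  exact hv.lip t x y

theorem coeff_integrable (hv : IsCaratheodory v a R) : Integrable a timeMeasure :=
  hv.memLp.integrable (by norm_num)

theorem integrable_comp (hv : IsCaratheodory v a R) (hu : ContinuousOn u (Icc 0 1)) :
    Integrable (fun s => v s (u s)) timeMeasure := by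
  obtain ⟨C, hC⟩ := isCompact_Icc.exists_bound_of_continuousOn hu
  refine Integrable.mono' (hv.coeff_integrable.mul_const (R + C))
    (aestronglyMeasurable_caratheodory hv.meas hv.continuous
      (hu.aestronglyMeasurable_of_isCompact isCompact_Icc measurableSet_Icc)) ?_
  filter_upwards [ae_restrict_mem measurableSet_Icc] with s hs
  refine (hv.growth s (u s)).trans ?_
  gcongr
  · exact hv.coeff_nonneg s
  · exact hC s hs

theorem continuousOn_extend (u : C(Icc (0 : ℝ) 1, E)) :
    ContinuousOn (IccExtend zero_le_one u) (Icc (0 : ℝ) 1) :=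
  (u.continuous.Icc_extend' (h := zero_le_one)).continuousOn

theorem measurePreserving_one_sub :
    MeasurePreserving (fun t : ℝ => 1 - t) timeMeasure timeMeasure := by
  have h := (Measure.measurePreserving_sub_left (volume : Measure ℝ) 1).restrict_preimage
    (measurableSet_Icc (a := (0 : ℝ)) (b := 1))
  have h2 : (fun t : ℝ => 1 - t) ⁻¹' Icc 0 1 = Icc 0 1 := by
    simp
  rwa [h2] at h

/-- Time reversal of a vector field. -/
theorem reverse (hv : IsCaratheodory v a R) :
    IsCaratheodory (fun t x => -v (1 - t) x) (fun t => a (1 - t)) R where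
  meas x := ((hv.meas x).comp_measurePreserving measurePreserving_one_sub).neg
  lip t x y := by
    rw [neg_sub_neg, norm_sub_rev]
    exact hv.lip _ _ _
  growth t x := by
    rw [norm_neg]
    exact hv.growth _ _
  coeff_nonneg t := hv.coeff_nonneg _
  radius_nonneg := hv.radius_nonneg
  memLp := hv.memLp.comp_measurePreserving measurePreserving_one_sub

theorem intervalIntegrable_comp (hv : IsCaratheodory v a R) (hu : ContinuousOn u (Icc 0 1))
    {s t : ℝ} (hs : s ∈ Icc (0 : ℝ) 1) (ht : t ∈ Icc (0 : ℝ) 1) :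
    IntervalIntegrable (fun s => v s (u s)) volume s t :=
  intervalIntegrable_of_timeMeasure (hv.integrable_comp hu) hs ht

theorem coeff_mul_intervalIntegrable {g : ℝ → ℝ} (ha : Integrable a timeMeasure)
    (hg : ContinuousOn g (Icc 0 1)) {s t : ℝ} (hs : s ∈ Icc (0 : ℝ) 1) (ht : t ∈ Icc (0 : ℝ) 1) :
    IntervalIntegrable (fun s => a s * g s) volume s t := by
  refine intervalIntegrable_of_timeMeasure ?_ hs ht
  obtain ⟨C, hC⟩ := isCompact_Icc.exists_bound_of_continuousOn hg
  refine ha.mul_bdd (c := C)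
    (hg.aestronglyMeasurable_of_isCompact isCompact_Icc measurableSet_Icc) ?_
  filter_upwards [ae_restrict_mem measurableSet_Icc] with s hs using hC s hs

variable [NormedSpace ℝ E]

/-- The integral operator of a vector field is controlled by its Lipschitz constant. -/
theorem norm_integral_sub_le (hv : IsCaratheodory v a R) (hu : ContinuousOn u (Icc 0 1))
    (hp : ContinuousOn p (Icc 0 1)) {t : ℝ} (ht : t ∈ Icc (0 : ℝ) 1) :
    ‖(∫ s in (0 : ℝ)..t, v s (u s)) - ∫ s in (0 : ℝ)..t, v s (p s)‖ ≤
      ∫ s in (0 : ℝ)..t, a s * ‖u s - p s‖ := by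
  have h0 : (0 : ℝ) ∈ Icc (0 : ℝ) 1 := ⟨le_rfl, zero_le_one⟩
  rw [← intervalIntegral.integral_sub (hv.intervalIntegrable_comp hu h0 ht)
    (hv.intervalIntegrable_comp hp h0 ht)]
  exact intervalIntegral.norm_integral_le_of_norm_le ht.1
    (ae_of_all _ fun s _ => hv.lip s _ _)
    (coeff_mul_intervalIntegrable hv.coeff_integrable (hu.sub hp).norm h0 ht)

theorem norm_sub_le (hv : IsCaratheodory v a R) (hM : ∫ s, a s ^ 2 ∂timeMeasure ≤ M)
    (hu : IsIntegralCurveFrom v x u) (hp : IsIntegralCurveFrom v y p) {t : ℝ}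
    (ht : t ∈ Icc (0 : ℝ) 1) : ‖u t - p t‖ ≤ 2 * ‖x - y‖ * Real.exp M := by
  refine gronwall_memLp (g := fun t => ‖u t - p t‖) hv.memLp hM (norm_nonneg _)
    (hu.1.sub hp.1).norm (fun _ _ => norm_nonneg _) (fun t ht => ?_) t ht
  rw [hu.2.2 t ht, hp.2.2 t ht, add_sub_add_comm]
  refine (norm_add_le _ _).trans ?_
  gcongr
  exact hv.norm_integral_sub_le hu.1 hp.1 ht

theorem norm_add_radius_le (hv : IsCaratheodory v a R) (hM : ∫ s, a s ^ 2 ∂timeMeasure ≤ M)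
    (hu : IsIntegralCurveFrom v x u) {t : ℝ} (ht : t ∈ Icc (0 : ℝ) 1) :
    R + ‖u t‖ ≤ 2 * (R + ‖x‖) * Real.exp M := by
  have h0 : (0 : ℝ) ∈ Icc (0 : ℝ) 1 := ⟨le_rfl, zero_le_one⟩
  refine gronwall_memLp (g := fun t => R + ‖u t‖) hv.memLp hM
    (add_nonneg hv.radius_nonneg (norm_nonneg _)) (continuousOn_const.add hu.1.norm)
    (fun _ _ => add_nonneg hv.radius_nonneg (norm_nonneg _)) (fun t ht => ?_) t ht
  have h1 : ‖u t‖ ≤ ‖x‖ + ∫ s in (0 : ℝ)..t, a s * (R + ‖u s‖) := by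
    rw [hu.2.2 t ht]
    refine (norm_add_le _ _).trans ?_
    gcongr
    refine intervalIntegral.norm_integral_le_of_norm_le ht.1
      (ae_of_all _ fun s _ => hv.growth s _) ?_
    exact coeff_mul_intervalIntegrable hv.coeff_integrable (continuousOn_const.add hu.1.norm) h0 ht
  linarith

theorem eq_of_isIntegralCurveFrom (hv : IsCaratheodory v a R) (hu : IsIntegralCurveFrom v x u)
    (hp : IsIntegralCurveFrom v x p) {t : ℝ} (ht : t ∈ Icc (0 : ℝ) 1) : u t = p t := by
  have := hv.norm_sub_le le_rfl hu hp ht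
  simp only [sub_self, norm_zero, mul_zero, zero_mul] at this
  exact sub_eq_zero.1 (norm_le_zero_iff.1 this)

theorem continuousOn_primitive {f : ℝ → E} (hf : Integrable f timeMeasure) :
    ContinuousOn (fun t => ∫ s in (0 : ℝ)..t, f s) (Icc 0 1) := by
  have := intervalIntegral.continuousOn_primitive_interval
    (f := f) (μ := volume) (a := 0) (b := 1) (by rw [uIcc_of_le zero_le_one]; exact hf)
  rwa [uIcc_of_le zero_le_one] at this

/-- The Picard operator of a Carathéodory vector field. -/
def picard (hv : IsCaratheodory v a R) (x : E) (u : C(Icc (0 : ℝ) 1, E)) : C(Icc (0 : ℝ) 1, E) where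
  toFun t := x + ∫ s in (0 : ℝ)..t, v s (IccExtend zero_le_one u s)
  continuous_toFun :=
    continuous_const.add (continuousOn_iff_continuous_domRestrict.1
      (continuousOn_primitive (hv.integrable_comp (continuousOn_extend u))))

theorem picard_apply (hv : IsCaratheodory v a R) (x : E) (u : C(Icc (0 : ℝ) 1, E))
    (t : Icc (0 : ℝ) 1) :
    hv.picard x u t = x + ∫ s in (0 : ℝ)..t, v s (IccExtend zero_le_one u s) := rfl

/-- By induction: Cauchy-Schwarz costs a factor `M`, and integrating `r ^ n` gives `t ^ (n + 1) / (n
+ 1)`, which builds the factorial. -/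
theorem sq_dist_picard_iterate_le (hv : IsCaratheodory v a R)
    (hM : ∫ s, a s ^ 2 ∂timeMeasure ≤ M) (x : E) (u p : C(Icc (0 : ℝ) 1, E)) (n : ℕ)
    (t : Icc (0 : ℝ) 1) :
    ‖(hv.picard x)^[n] u t - (hv.picard x)^[n] p t‖ ^ 2 ≤
      (M ^ n / n.factorial * ‖u - p‖ ^ 2) * (t : ℝ) ^ n := by
  have hM0 : 0 ≤ M := (integral_nonneg fun _ => sq_nonneg _).trans hM
  have h0 : (0 : ℝ) ∈ Icc (0 : ℝ) 1 := ⟨le_rfl, zero_le_one⟩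
  induction n generalizing t with
  | zero => simpa using pow_le_pow_left₀ (norm_nonneg _) ((u - p).norm_coe_le_norm t) 2
  | succ n ih =>
    rw [Function.iterate_succ_apply', Function.iterate_succ_apply', picard_apply, picard_apply,
      add_sub_add_left_eq_sub]
    set U := (hv.picard x)^[n] u
    set P := (hv.picard x)^[n] p
    have hc : ContinuousOn (fun s => ‖IccExtend zero_le_one U s - IccExtend zero_le_one P s‖)
      (Icc (0 : ℝ) 1) := ((continuousOn_extend U).sub (continuousOn_extend P)).norm
    have h1 := hv.norm_integral_sub_le (continuousOn_extend U) (continuousOn_extend P) t.2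
    have h2 := sq_integral_Ioc_mul_le hv.memLp hM hc le_rfl t.2.1 t.2.2
    have h3 : ∫ r in (0 : ℝ)..t, ‖IccExtend zero_le_one U r - IccExtend zero_le_one P r‖ ^ 2 ≤
        ∫ r in (0 : ℝ)..t, (M ^ n / n.factorial * ‖u - p‖ ^ 2) * r ^ n := by
      refine intervalIntegral.integral_mono_on t.2.1
        (ContinuousOn.intervalIntegrable_unit (hc.pow 2) h0 t.2)
        (Continuous.intervalIntegrable (by fun_prop) _ _) fun s hs => ?_
      have hs' : s ∈ Icc (0 : ℝ) 1 := ⟨hs.1, hs.2.trans t.2.2⟩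
      rw [IccExtend_of_mem _ _ hs', IccExtend_of_mem _ _ hs']
      exact ih ⟨s, hs'⟩
    rw [intervalIntegral.integral_const_mul, integral_pow] at h3
    calc _ ≤ _ := pow_le_pow_left₀ (norm_nonneg _) h1 2
      _ ≤ _ := h2
      _ ≤ _ := mul_le_mul_of_nonneg_left h3 hM0
      _ = _ := by
        rw [Nat.factorial_succ]
        push_cast
        field_simp
        ring

theorem exists_isIntegralCurveFrom [CompleteSpace E] (hv : IsCaratheodory v a R) (x : E) :
    ∃ u, IsIntegralCurveFrom v x u := by
  set M := ∫ s, a s ^ 2 ∂timeMeasure with hM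
  have hM0 : 0 ≤ M := integral_nonneg fun _ => sq_nonneg _
  -- The estimate concerns squared distances, so `1/4` makes the iterate a `1/2`-contraction.
  obtain ⟨n, hn⟩ := ((FloorSemiring.tendsto_pow_div_factorial_atTop M).eventually_lt_const
    (show (0 : ℝ) < 1 / 4 by norm_num)).exists
  have hcontr : ContractingWith (1 / 2) ((hv.picard x)^[n]) := by
    refine ⟨by rw [← NNReal.coe_lt_coe]; norm_num, LipschitzWith.of_dist_le_mul fun u p => ?_⟩
    rw [ContinuousMap.dist_le (by positivity)]
    intro t
    rw [dist_eq_norm, dist_eq_norm]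
    have h1 := hv.sq_dist_picard_iterate_le hM.ge x u p n t
    refine abs_le_of_sq_le_sq' ?_ (by positivity) |>.2
    calc _ ≤ _ := h1
      _ ≤ (1 / 4 * ‖u - p‖ ^ 2) * 1 := by
        gcongr
        · exact pow_nonneg t.2.1 n
        · exact pow_le_one₀ t.2.1 t.2.2
      _ = _ := by
        push_cast
        ring
  -- The unique fixed point of an iterate is already fixed by the Picard operator itself.
  have hfix := hcontr.isFixedPt_fixedPoint_iterate
  set U := ContractingWith.fixedPoint ((hv.picard x)^[n]) hcontr
  refine ⟨IccExtend zero_le_one U, continuousOn_extend U, hv.intervalIntegrable_comp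
    (continuousOn_extend U) ⟨le_rfl, zero_le_one⟩ ⟨zero_le_one, le_rfl⟩, fun t ht => ?_⟩
  conv_lhs => rw [IccExtend_of_mem _ _ ht, ← hfix]
  rw [picard_apply]

theorem isIntegralCurveFrom_reverse (hv : IsCaratheodory v a R) (hu : IsIntegralCurveFrom v x u) :
    IsIntegralCurveFrom (fun t x => -v (1 - t) x) (u 1) (fun t => u (1 - t)) := by
  have h1 : (1 : ℝ) ∈ Icc (0 : ℝ) 1 := ⟨zero_le_one, le_rfl⟩
  have h0 : (0 : ℝ) ∈ Icc (0 : ℝ) 1 := ⟨le_rfl, zero_le_one⟩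
  have hmaps : MapsTo (fun t : ℝ => 1 - t) (Icc 0 1) (Icc 0 1) := fun t ht =>
    ⟨by linarith [ht.2], by linarith [ht.1]⟩
  have hc : ContinuousOn (fun t => u (1 - t)) (Icc 0 1) :=
    hu.1.comp (by fun_prop) hmaps
  refine ⟨hc, hv.reverse.intervalIntegrable_comp hc h0 h1, fun t ht => ?_⟩
  have ht' : 1 - t ∈ Icc (0 : ℝ) 1 := hmaps ht
  rw [intervalIntegral.integral_neg, intervalIntegral.integral_comp_sub_left
    (fun s => v s (u s)) 1, sub_zero]
  simp only
  rw [hu.2.2 _ ht', hu.2.2 _ h1,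
    ← intervalIntegral.integral_add_adjacent_intervals
      (hv.intervalIntegrable_comp hu.1 h0 ht') (hv.intervalIntegrable_comp hu.1 ht' h1)]
  abel

/-- The time-one map of a Carathéodory vector field is a bi-Lipschitz homeomorphism. -/
theorem exists_homeomorph [CompleteSpace E] (hv : IsCaratheodory v a R) {T : E → E}
    (hT : ∀ x, ∃ u, IsIntegralCurveFrom v x u ∧ u 1 = T x) :
    ∃ h : E ≃ₜ E, (∀ x, h x = T x) ∧ (∃ C, LipschitzWith C h) ∧ ∃ C, LipschitzWith C h.symm := by
  have h1 : (1 : ℝ) ∈ Icc (0 : ℝ) 1 := ⟨zero_le_one, le_rfl⟩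
  choose u hu huT using hT
  choose p hp using hv.reverse.exists_isIntegralCurveFrom
  have hlip : ∀ {w : ℝ → E → E} {b : ℝ → ℝ} {q : E → ℝ → E}, IsCaratheodory w b R →
      (∀ x, IsIntegralCurveFrom w x (q x)) → ∃ C, LipschitzWith C (fun x => q x 1) := by
    intro w b q hw hq
    refine ⟨_, LipschitzWith.of_dist_le' (K := 2 * Real.exp (∫ s, b s ^ 2 ∂timeMeasure))
      fun x y => ?_⟩
    rw [dist_eq_norm, dist_eq_norm]
    exact (hw.norm_sub_le le_rfl (hq x) (hq y) h1).trans (le_of_eq (by ring))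
  obtain ⟨C, hC⟩ := hlip hv hu
  obtain ⟨D, hD⟩ := hlip hv.reverse hp
  have hinit : ∀ {w : ℝ → E → E} {q : ℝ → E} {x : E}, IsIntegralCurveFrom w x q → q 0 = x := by
    intro w q x hq
    simpa using hq.2.2 0 ⟨le_rfl, zero_le_one⟩
  have hfun : (fun x => u x 1) = T := funext huT
  let e : E ≃ₜ E :=
    { toFun := fun x => u x 1
      invFun := fun y => p y 1
      left_inv := fun x => by
        -- The curve from `x` run backwards solves the reversed problem from `u x 1`; by uniqueness
        -- it is the chosen one, hence ends at `x`.
        have := hv.reverse.eq_of_isIntegralCurveFrom (hp (u x 1))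
          (hv.isIntegralCurveFrom_reverse (hu x)) h1
        simp only [this, sub_self, hinit (hu x)]
      right_inv := fun y => by
        have h2 := hv.reverse.isIntegralCurveFrom_reverse (hp y)
        simp only [sub_sub_cancel, neg_neg] at h2
        have := hv.eq_of_isIntegralCurveFrom (hu (p y 1)) h2 h1
        simp only [this, sub_self, hinit (hp y)]
      continuous_toFun := hC.continuous
      continuous_invFun := hD.continuous }
  exact ⟨e, huT, ⟨C, hC⟩, D, hD⟩

end IsCaratheodory

end Caratheodory

/-! ### Stability of integral curves under weak convergence -/

section Stability

variable {E : Type*} [NormedAddCommGroup E]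

/-- The image of `u` is compact, so projecting to a nearest point of a finite net gives an
approximation uniform in time. -/
theorem exists_simpleFunc_norm_sub_le {u : ℝ → E} (hu : ContinuousOn u (Icc 0 1)) {ε : ℝ}
    (hε : 0 < ε) : ∃ g : SimpleFunc ℝ E, ∀ s ∈ Icc (0 : ℝ) 1, ‖u s - g s‖ ≤ ε := by
  borelize E
  have hc : Continuous (IccExtend zero_le_one ((Icc (0 : ℝ) 1).domRestrict u)) :=
    (continuousOn_iff_continuous_domRestrict.1 hu).Icc_extend'
  have hK : IsCompact (u '' Icc 0 1) := isCompact_Icc.image_of_continuousOn hu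
  obtain ⟨t, -, htf, htc⟩ := hK.finite_cover_balls hε
  have h0 : (u '' Icc 0 1).Nonempty := ⟨u 0, 0, ⟨le_rfl, zero_le_one⟩, rfl⟩
  have htne : t.Nonempty := by
    obtain ⟨y, hy⟩ := h0
    obtain ⟨x, hx, -⟩ := mem_iUnion₂.1 (htc hy)
    exact ⟨x, hx⟩
  obtain ⟨e, he⟩ := htf.countable.exists_eq_range htne
  -- `nearestPt e N` only sees `e 0, …, e N`, so `N` must be large enough to reach the whole net.
  have hfin : ∃ N, ∀ x ∈ t, ∃ k ≤ N, e k = x := by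
    have h1 : ∀ x ∈ t, ∃ k, e k = x := fun x hx => by rw [he] at hx; exact hx
    choose! k hk using h1
    obtain ⟨N, hN⟩ := (htf.image k).bddAbove
    exact ⟨N, fun x hx => ⟨k x, hN ⟨x, hx, rfl⟩, hk x hx⟩⟩
  obtain ⟨N, hN⟩ := hfin
  refine ⟨(SimpleFunc.nearestPt e N).comp _ hc.measurable, fun s hs => ?_⟩
  obtain ⟨x, hx, hxs⟩ := mem_iUnion₂.1 (htc (mem_image_of_mem u hs))
  obtain ⟨k, hk, rfl⟩ := hN x hx
  have h1 := SimpleFunc.edist_nearestPt_le e (u s) hk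
  rw [SimpleFunc.coe_comp, Function.comp_apply, IccExtend_of_mem _ _ hs, domRestrict_apply,
    ← dist_eq_norm, dist_comm]
  rw [edist_dist, edist_dist, ENNReal.ofReal_le_ofReal_iff dist_nonneg] at h1
  rw [Metric.mem_ball, dist_comm] at hxs
  exact h1.trans hxs.le

namespace IsCaratheodory

variable {ι : Type*} {l : Filter ι} {v : ι → ℝ → E → E} {a : ι → ℝ → ℝ} {w : ℝ → E → E}
  {b : ℝ → ℝ} {R M : ℝ}

theorem integral_coeff_le (hw : IsCaratheodory w b R) (hM : ∫ s, b s ^ 2 ∂timeMeasure ≤ M) :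
    ∫ s, b s ∂timeMeasure ≤ Real.sqrt M := by
  refine Real.le_sqrt_of_sq_le ?_
  have := sq_integral_mul_le hw.memLp (memLp_const (1 : ℝ) (p := 2) (μ := timeMeasure))
  simp only [mul_one, one_pow, integral_const, measureReal_restrict_apply_univ, smul_eq_mul,
    Real.volume_real_Icc, sub_zero, zero_le_one, sup_of_le_left] at this
  exact this.trans hM

theorem integrable_const (hw : IsCaratheodory w b R) (c : E) :
    Integrable (fun s => w s c) timeMeasure :=
  hw.integrable_comp (u := fun _ => c) continuousOn_const

theorem integrable_simpleFunc (hw : IsCaratheodory w b R) (g : SimpleFunc ℝ E) :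
    Integrable (fun s => w s (g s)) timeMeasure := by
  classical
  simp_rw [caratheodory_simpleFunc_eq_sum w g]
  exact integrable_finsetSum _ fun c _ =>
    (hw.integrable_const c).indicator (g.measurableSet_fiber c)

variable [NormedSpace ℝ E]

open Classical in
theorem setIntegral_simpleFunc (hw : IsCaratheodory w b R) (g : SimpleFunc ℝ E) (A : Set ℝ) :
    ∫ s in A, w s (g s) ∂timeMeasure =
      ∑ c ∈ g.range, ∫ s in A ∩ g ⁻¹' {c}, w s c ∂timeMeasure := by
  simp_rw [caratheodory_simpleFunc_eq_sum w g]
  rw [integral_finsetSum]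
  · exact Finset.sum_congr rfl fun c _ => setIntegral_indicator (g.measurableSet_fiber c)
  · exact fun c _ => ((hw.integrable_const c).indicator (g.measurableSet_fiber c)).integrableOn

/-- The error depends on the field only through `M`, so it is uniform along a family of fields with
a common bound. -/
theorem norm_setIntegral_sub_simpleFunc_le (hw : IsCaratheodory w b R)
    (hM : ∫ s, b s ^ 2 ∂timeMeasure ≤ M) {u : ℝ → E} (hu : ContinuousOn u (Icc 0 1))
    {g : SimpleFunc ℝ E} {ε : ℝ} (hg : ∀ s ∈ Icc (0 : ℝ) 1, ‖u s - g s‖ ≤ ε) (hε : 0 ≤ ε)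
    (A : Set ℝ) :
    ‖(∫ s in A, w s (u s) ∂timeMeasure) - ∫ s in A, w s (g s) ∂timeMeasure‖ ≤
      Real.sqrt M * ε := by
  rw [← integral_sub (hw.integrable_comp hu).integrableOn (hw.integrable_simpleFunc g).integrableOn]
  calc _ ≤ ∫ s in A, b s * ε ∂timeMeasure := by
        refine norm_integral_le_of_norm_le (hw.coeff_integrable.mul_const ε).integrableOn ?_
        refine ae_restrict_of_ae ?_
        filter_upwards [ae_restrict_mem measurableSet_Icc] with s hs
        exact (hw.lip s _ _).trans (mul_le_mul_of_nonneg_left (hg s hs) (hw.coeff_nonneg s))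
    _ ≤ ∫ s, b s * ε ∂timeMeasure := setIntegral_le_integral (hw.coeff_integrable.mul_const ε)
        (ae_of_all _ fun s => mul_nonneg (hw.coeff_nonneg s) hε)
    _ ≤ _ := by
        rw [integral_mul_const]
        gcongr
        exact hw.integral_coeff_le hM

/-- Weak convergence of the values of vector fields passes to their values along a continuous
curve. -/
theorem tendsto_setIntegral_comp (hv : ∀ n, IsCaratheodory (v n) (a n) R)
    (hM : ∀ n, ∫ s, a n s ^ 2 ∂timeMeasure ≤ M) (hw : IsCaratheodory w b R)
    (hMb : ∫ s, b s ^ 2 ∂timeMeasure ≤ M)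
    (hweak : ∀ c A, MeasurableSet A → Tendsto (fun n => ∫ s in A, v n s c ∂timeMeasure) l
      (𝓝 (∫ s in A, w s c ∂timeMeasure)))
    {u : ℝ → E} (hu : ContinuousOn u (Icc 0 1)) {A : Set ℝ} (hA : MeasurableSet A) :
    Tendsto (fun n => ∫ s in A, v n s (u s) ∂timeMeasure) l
      (𝓝 (∫ s in A, w s (u s) ∂timeMeasure)) := by
  classical
  rw [Metric.tendsto_nhds]
  intro ε hε
  -- Two approximation errors of at most `ε / 4`, plus `ε / 4` from the simple function, stay below
  -- `ε`.
  set δ : ℝ := ε / (4 * (Real.sqrt M + 1)) with hδ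
  have hδ0 : 0 < δ := by positivity
  have hδε : Real.sqrt M * δ ≤ ε / 4 := by
    rw [hδ, mul_div_assoc', div_le_div_iff₀ (by positivity) (by norm_num)]
    nlinarith [Real.sqrt_nonneg M]
  obtain ⟨g, hg⟩ := exists_simpleFunc_norm_sub_le hu hδ0
  have hs : Tendsto (fun n => ∫ s in A, v n s (g s) ∂timeMeasure) l
      (𝓝 (∫ s in A, w s (g s) ∂timeMeasure)) := by
    simp_rw [fun n => (hv n).setIntegral_simpleFunc g A, hw.setIntegral_simpleFunc g A]
    exact tendsto_finsetSum _ fun c _ => hweak c _ (hA.inter (g.measurableSet_fiber c))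
  filter_upwards [Metric.tendsto_nhds.1 hs (ε / 4) (by positivity)] with n hn
  have h1 := ((hv n).norm_setIntegral_sub_simpleFunc_le (hM n) hu hg hδ0.le A).trans hδε
  have h2 := (hw.norm_setIntegral_sub_simpleFunc_le hMb hu hg hδ0.le A).trans hδε
  rw [← dist_eq_norm] at h1 h2
  rw [dist_comm] at h2
  have h3 := dist_triangle4 (∫ s in A, v n s (u s) ∂timeMeasure)
    (∫ s in A, v n s (g s) ∂timeMeasure) (∫ s in A, w s (g s) ∂timeMeasure)
    (∫ s in A, w s (u s) ∂timeMeasure)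
  linarith

/-- Hölder continuity of exponent `1/2` in time, with a constant common to all fields with the same
`M`: the source of equicontinuity. -/
theorem norm_intervalIntegral_comp_le (hw : IsCaratheodory w b R)
    (hM : ∫ s, b s ^ 2 ∂timeMeasure ≤ M) {u : ℝ → E} {C : ℝ}
    (hC : ∀ s ∈ Icc (0 : ℝ) 1, R + ‖u s‖ ≤ C) {s t : ℝ} (hs : s ∈ Icc (0 : ℝ) 1)
    (ht : t ∈ Icc (0 : ℝ) 1) :
    ‖∫ r in s..t, w r (u r)‖ ≤ Real.sqrt M * C * Real.sqrt (dist s t) := by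
  wlog hst : s ≤ t generalizing s t
  · rw [intervalIntegral.integral_symm, norm_neg, dist_comm]
    exact this ht hs (le_of_not_ge hst)
  have hM0 : 0 ≤ M := (integral_nonneg fun _ => sq_nonneg _).trans hM
  have hC0 : 0 ≤ C := (add_nonneg hw.radius_nonneg (norm_nonneg _)).trans (hC s hs)
  have h1 : ‖∫ r in s..t, w r (u r)‖ ≤ ∫ r in s..t, b r * C := by
    refine intervalIntegral.norm_integral_le_of_norm_le hst ?_
      (coeff_mul_intervalIntegrable hw.coeff_integrable continuousOn_const hs ht)
    refine ae_of_all _ fun r hr => (hw.growth r _).trans ?_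
    exact mul_le_mul_of_nonneg_left (hC r ⟨hs.1.trans hr.1.le, hr.2.trans ht.2⟩)
      (hw.coeff_nonneg r)
  have h2 := sq_integral_Ioc_mul_le (g := fun _ => C) hw.memLp hM continuousOn_const hs.1 hst ht.2
  rw [intervalIntegral.integral_const, smul_eq_mul] at h2
  rw [dist_comm, Real.dist_eq, abs_of_nonneg (sub_nonneg.2 hst)]
  refine h1.trans (abs_le_of_sq_le_sq' ?_ (by positivity)).2
  rw [mul_pow, mul_pow, Real.sq_sqrt hM0, Real.sq_sqrt (sub_nonneg.2 hst)]
  refine h2.trans (le_of_eq (by ring))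

/-- Stability of integral curves under weak convergence of the vector fields. -/
theorem tendsto_integralCurve (hv : ∀ n, IsCaratheodory (v n) (a n) R)
    (hM : ∀ n, ∫ s, a n s ^ 2 ∂timeMeasure ≤ M) (hw : IsCaratheodory w b R)
    (hMb : ∫ s, b s ^ 2 ∂timeMeasure ≤ M)
    (hweak : ∀ c A, MeasurableSet A → Tendsto (fun n => ∫ s in A, v n s c ∂timeMeasure) l
      (𝓝 (∫ s in A, w s c ∂timeMeasure)))
    {x : E} {u : ℝ → E} {p : ι → ℝ → E} (hu : IsIntegralCurveFrom w x u)
    (hp : ∀ n, IsIntegralCurveFrom (v n) x (p n)) :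
    Tendsto (fun n => p n 1) l (𝓝 (u 1)) := by
  have h0 : (0 : ℝ) ∈ Icc (0 : ℝ) 1 := ⟨le_rfl, zero_le_one⟩
  have h1 : (1 : ℝ) ∈ Icc (0 : ℝ) 1 := ⟨zero_le_one, le_rfl⟩
  obtain ⟨K, hK⟩ := isCompact_Icc.exists_bound_of_continuousOn hu.1
  set C := R + K
  have hC : ∀ s ∈ Icc (0 : ℝ) 1, R + ‖u s‖ ≤ C := fun s hs => by
    have := hK s hs
    simp only [C]
    linarith
  let F : ι → Icc (0 : ℝ) 1 → E := fun n t => ∫ s in (0 : ℝ)..t, v n s (u s)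
  let G : Icc (0 : ℝ) 1 → E := fun t => ∫ s in (0 : ℝ)..t, w s (u s)
  have hequi : Equicontinuous F := by
    refine Metric.equicontinuous_of_continuity_modulus
      (fun r => Real.sqrt M * C * Real.sqrt r) ?_ F fun s t n => ?_
    · have : Continuous (fun r => Real.sqrt M * C * Real.sqrt r) := by fun_prop
      simpa using this.tendsto 0
    · rw [dist_eq_norm, norm_sub_rev]
      simp only [F]
      rw [intervalIntegral.integral_interval_sub_left ((hv n).intervalIntegrable_comp hu.1 h0 t.2)
        ((hv n).intervalIntegrable_comp hu.1 h0 s.2)]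
      exact (hv n).norm_intervalIntegral_comp_le (hM n) hC s.2 t.2
  have hpt : Tendsto F l (𝓝 G) := by
    rw [tendsto_pi_nhds]
    intro t
    have := tendsto_setIntegral_comp hv hM hw hMb hweak hu.1 
      (measurableSet_Ioc (a := (0 : ℝ)) (b := t))
    rw [timeMeasure_restrict_Ioc le_rfl t.2.2] at this
    simpa only [F, G, intervalIntegral.integral_of_le t.2.1] using this
  -- Equicontinuity on the compact time interval upgrades pointwise to uniform convergence, along
  -- any filter.
  have hunif : TendstoUniformly F G l :=
    UniformFun.tendsto_iff_tendstoUniformly.1 ((hequi.tendsto_uniformFun_iff_pi l G).2 hpt)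
  rw [Metric.tendsto_nhds]
  intro ε hε
  rw [Metric.tendstoUniformly_iff] at hunif
  filter_upwards [hunif (ε / (4 * Real.exp M)) (by positivity)] with n hn
  -- Inserting `∫ v n s (u s)` splits `p n - u` into a Lipschitz term, absorbed by Grönwall, and a
  -- uniformly small term. The bound equals `ε / 2`.
  have hgr : ‖p n 1 - u 1‖ ≤ 2 * (ε / (4 * Real.exp M)) * Real.exp M := by
    refine gronwall_memLp (g := fun t => ‖p n t - u t‖) (hv n).memLp (hM n) (by positivity)
      ((hp n).1.sub hu.1).norm (fun _ _ => norm_nonneg _) (fun t ht => ?_) 1 h1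
    have e1 := (hv n).norm_integral_sub_le (hp n).1 hu.1 ht
    have e2 := (hn ⟨t, ht⟩).le
    rw [dist_comm, dist_eq_norm] at e2
    rw [(hp n).2.2 t ht, hu.2.2 t ht, add_sub_add_left_eq_sub]
    refine (norm_sub_le_norm_sub_add_norm_sub _ (∫ s in (0 : ℝ)..t, v n s (u s)) _).trans ?_
    rw [add_comm]
    exact add_le_add e2 e1
  rw [dist_eq_norm]
  refine hgr.trans_lt ?_
  have := Real.exp_pos M
  field_simp
  linarith

end IsCaratheodory

end Stability

/-! ### Linear maps and integrals against vector measures -/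

section VectorIntegral

variable {X E E' F F' G G' : Type*} [MeasurableSpace X]
  [NormedAddCommGroup E] [NormedSpace ℝ E] [NormedAddCommGroup E'] [NormedSpace ℝ E']
  [NormedAddCommGroup F] [NormedSpace ℝ F] [NormedAddCommGroup F'] [NormedSpace ℝ F']
  [NormedAddCommGroup G] [NormedSpace ℝ G] [NormedAddCommGroup G'] [NormedSpace ℝ G']

theorem integral_indicator_const_vectorMeasure [CompleteSpace G] (μ : VectorMeasure X F)
    (B : E →L[ℝ] F →L[ℝ] G) {s : Set X} (hs : MeasurableSet s) (hμs : μ.variation s < ∞) (c : E) :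
    μ.integral (s.indicator fun _ => c) B = B c (μ s) :=
  setToFun_indicator_const (dominatedFinMeasAdditive_cbmApplyMeasure μ B) hs hμs.ne c

/-- Linear maps acting on the integrand and on the value of a vector integral. -/
theorem map_vectorIntegral [CompleteSpace G] [CompleteSpace G'] (μ : VectorMeasure X F)
    {B : E →L[ℝ] F →L[ℝ] G} {B' : E' →L[ℝ] F →L[ℝ] G'} (A : E →L[ℝ] E') (C : G →L[ℝ] G')
    (h : ∀ x y, C (B x y) = B' (A x) y) {f : X → E} (hf : μ.Integrable f) :
    C (μ.integral f B) = μ.integral (fun x => A (f x)) B' := by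
  refine Integrable.induction (P := fun f => C (μ.integral f B) = μ.integral (fun x => A (f x)) B')
    (fun c s hs hμs => ?_) (fun f g _ hf hg h1 h2 => ?_) ?_ (fun f g hfg hf h1 => ?_) hf
  · have h1 : (fun x => A (s.indicator (fun _ => c) x)) = s.indicator (fun _ => A c) := by
      funext x
      by_cases hx : x ∈ s <;> simp [hx]
    rw [h1, integral_indicator_const_vectorMeasure μ B hs hμs,
      integral_indicator_const_vectorMeasure μ B' hs hμs, h]
  · have h3 : (fun x => A ((f + g) x)) = (fun x => A (f x)) + fun x => A (g x) := by
      funext x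
      simp
    rw [h3, VectorMeasure.integral_add hf hg, map_add, h1, h2,
      VectorMeasure.integral_add (A.integrable_comp hf) (A.integrable_comp hg)]
  · refine isClosed_eq (C.continuous.comp VectorMeasure.continuous_integral) ?_
    have h4 : (fun f : Lp E 1 μ.variation => μ.integral (fun x => A (f x)) B') =
        fun f => μ.integral (A.compLp f) B' := by
      funext f
      exact VectorMeasure.integral_congr_ae (EventuallyEq.symm (A.coeFn_compLp f))
    rw [h4]
    exact VectorMeasure.continuous_integral.comp (A.compLpL 1 μ.variation).continuous
  · rw [← VectorMeasure.integral_congr_ae hfg, h1]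
    exact VectorMeasure.integral_congr_ae (hfg.fun_comp A)

/-- Integration against the image of a vector measure under a linear map of the values. -/
theorem vectorIntegral_mapRange (μ : VectorMeasure X F) [IsFiniteMeasure μ.variation]
    (B : E →L[ℝ] F' →L[ℝ] G) (B' : E →L[ℝ] F →L[ℝ] G) (A : F →L[ℝ] F')
    (h : ∀ x y, B' x y = B x (A y)) {f : X → E} (hf : μ.Integrable f) :
    (μ.mapRange A.toLinearMap.toAddMonoidHom A.continuous).integral f B = μ.integral f B' := by
  have ht : (μ.mapRange A.toLinearMap.toAddMonoidHom A.continuous).transpose B =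
      μ.transpose B' := by
    ext s hs x
    exact (h x (μ s)).symm
  -- By `ht` both integrals extend the same transposed measure, but they are dominated by different
  -- variations; this inequality allows the change of dominating measure.
  have hv : (μ.mapRange A.toLinearMap.toAddMonoidHom A.continuous).variation ≤
      (‖A‖₊ : ℝ≥0∞) • μ.variation := by
    refine VectorMeasure.variation_le_of_forall_enorm_le fun s hs => ?_
    rw [Measure.smul_apply, smul_eq_mul]
    refine (A.le_opENorm (μ s)).trans ?_
    gcongr
    · exact le_rfl
    · exact VectorMeasure.enorm_measure_le_variation μ s
  have hd : DominatedFinMeasAdditive (μ.mapRange A.toLinearMap.toAddMonoidHom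
      A.continuous).variation (μ.transpose B') ‖B‖ := by
    rw [← ht]
    exact dominatedFinMeasAdditive_cbmApplyMeasure _ B
  unfold VectorMeasure.integral
  rw [setToFun_congr_measure_of_integrable (‖A‖₊ : ℝ≥0∞) ENNReal.coe_ne_top hv
    (dominatedFinMeasAdditive_cbmApplyMeasure μ B') hd f hf]
  exact setToFun_congr_left _ _ (congrArg _ ht) f

end VectorIntegral

/-! ### The duality pairing, the total variation norm and the field `K ⋆ Γ` -/

section Pairing

variable {d : ℕ} {Ω : Set (Euc d)}

instance (Γ : VecMeas Ω) : IsFiniteMeasure Γ.variation := ⟨variation_univ_lt_top Γ⟩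

theorem le_tvNorm (Γ : VecMeas Ω) (f : C(Ω, Euc d)) (hf : ∀ z, ‖f z‖ ≤ 1) :
    ENNReal.ofReal (pairing Γ f) ≤ tvNorm Γ :=
  le_iSup₂ (f := fun (f : C(Ω, Euc d)) (_ : ∀ z, ‖f z‖ ≤ 1) => ENNReal.ofReal (pairing Γ f)) f hf

theorem pairing_le_variation (Γ : VecMeas Ω) (f : C(Ω, Euc d)) (hf : ∀ z, ‖f z‖ ≤ 1) :
    ENNReal.ofReal (pairing Γ f) ≤ ‖innerSL ℝ (E := Euc d)‖ₑ * Γ.variation univ := by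
  refine (ENNReal.ofReal_le_ofReal (le_abs_self _)).trans ?_
  rw [← Real.norm_eq_abs, ofReal_norm]
  refine (VectorMeasure.enorm_integral_le_lintegral_enorm (B := innerSL ℝ)).trans ?_
  gcongr
  calc ∫⁻ z, ‖f z‖ₑ ∂Γ.variation ≤ ∫⁻ _, 1 ∂Γ.variation := by
        refine lintegral_mono fun z => ?_
        rw [← ofReal_norm]
        exact ENNReal.ofReal_le_one.2 (hf z)
    _ = _ := by simp

theorem tvNorm_lt_top (Γ : VecMeas Ω) : tvNorm Γ < ∞ :=
  (iSup₂_le (pairing_le_variation Γ)).trans_lt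
    (ENNReal.mul_lt_top enorm_lt_top (variation_univ_lt_top Γ))

variable [CompactSpace Ω]

theorem integrable_continuousMap {F : Type*} [NormedAddCommGroup F] (Γ : VecMeas Ω) (f : C(Ω, F)) :
    Γ.Integrable f :=
  f.continuous.integrable_of_hasCompactSupport (HasCompactSupport.of_compactSpace f)

/-- The duality pairing with a vector measure, as a linear functional. -/
def pairingₗ (Γ : VecMeas Ω) : C(Ω, Euc d) →ₗ[ℝ] ℝ where
  toFun f := pairing Γ f
  map_add' f g :=
    VectorMeasure.integral_add (integrable_continuousMap Γ f) (integrable_continuousMap Γ g)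
  map_smul' c _ := VectorMeasure.integral_smul _ _ _ c

@[simp]
theorem pairingₗ_apply (Γ : VecMeas Ω) (f : C(Ω, Euc d)) : pairingₗ Γ f = pairing Γ f := rfl

theorem pairing_le (Γ : VecMeas Ω) (f : C(Ω, Euc d)) :
    pairing Γ f ≤ (tvNorm Γ).toReal * ‖f‖ := by
  rcases eq_or_ne ‖f‖ 0 with h | h
  · rw [norm_eq_zero] at h
    have := (pairingₗ Γ).map_zero
    rw [pairingₗ_apply] at this
    rw [h, this, norm_zero, mul_zero]
  · have hpos : 0 < ‖f‖ := lt_of_le_of_ne (norm_nonneg _) h.symm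
    have h1 : ∀ z, ‖(‖f‖⁻¹ • f) z‖ ≤ 1 := fun z => by
      rw [ContinuousMap.smul_apply, norm_smul, norm_inv, norm_norm, inv_mul_le_one₀ hpos]
      exact f.norm_coe_le_norm z
    have h2 := le_tvNorm Γ _ h1
    rw [ENNReal.ofReal_le_iff_le_toReal (tvNorm_lt_top Γ).ne, ← pairingₗ_apply, map_smul,
      smul_eq_mul, inv_mul_le_iff₀ hpos, mul_comm] at h2
    exact h2

theorem abs_pairing_le (Γ : VecMeas Ω) (f : C(Ω, Euc d)) :
    |pairing Γ f| ≤ (tvNorm Γ).toReal * ‖f‖ := by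
  refine abs_le.2 ⟨?_, pairing_le Γ f⟩
  have h := pairing_le Γ (-f)
  rw [← pairingₗ_apply, map_neg, norm_neg, pairingₗ_apply] at h
  linarith

theorem tvNorm_le_of_forall {Γ : VecMeas Ω} {b : ℝ} (hb : 0 ≤ b)
    (h : ∀ f : C(Ω, Euc d), pairing Γ f ≤ b * ‖f‖) : tvNorm Γ ≤ ENNReal.ofReal b := by
  refine iSup₂_le fun f hf => ENNReal.ofReal_le_ofReal ((h f).trans ?_)
  exact mul_le_of_le_one_right hb ((ContinuousMap.norm_le f zero_le_one).2 hf)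

theorem continuous_pairing (Γ : VecMeas Ω) : Continuous fun f : C(Ω, Euc d) => pairing Γ f :=
  ((pairingₗ Γ).mkContinuous (tvNorm Γ).toReal fun f => abs_pairing_le Γ f).continuous

/-- The unit ball of `C(Ω, ℝᵈ)` is separable and the pairing is continuous, so the supremum may be
taken over a countable dense family. -/
theorem aemeasurable_tvNorm {α : Type*} [MeasurableSpace α] {μ : Measure α} {Γ : α → VecMeas Ω}
    (h : ∀ f : C(Ω, Euc d), AEMeasurable (fun t => pairing (Γ t) f) μ) :
    AEMeasurable (fun t => tvNorm (Γ t)) μ := by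
  let S : Set C(Ω, Euc d) := {f | ∀ z, ‖f z‖ ≤ 1}
  have : Nonempty S := ⟨⟨0, fun z => by simp⟩⟩
  let e : ℕ → S := TopologicalSpace.denseSeq S
  have heq : ∀ t, tvNorm (Γ t) = ⨆ n, ENNReal.ofReal (pairing (Γ t) (e n : C(Ω, Euc d))) := by
    intro t
    refine le_antisymm (iSup₂_le fun f hf => ?_) (iSup_le fun n => le_tvNorm (Γ t) _ (e n).2)
    have hc : Continuous fun f : S => ENNReal.ofReal (pairing (Γ t) (f : C(Ω, Euc d))) :=
      ENNReal.continuous_ofReal.comp ((continuous_pairing (Γ t)).comp continuous_subtype_val)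
    exact (TopologicalSpace.denseRange_denseSeq S).induction_on
      (p := fun f : S => ENNReal.ofReal (pairing (Γ t) (f : C(Ω, Euc d))) ≤
        ⨆ n, ENNReal.ofReal (pairing (Γ t) (e n : C(Ω, Euc d)))) ⟨f, hf⟩
      (isClosed_le hc continuous_const)
      fun n => le_iSup (fun n => ENNReal.ofReal (pairing (Γ t) (e n : C(Ω, Euc d)))) n
  simp_rw [heq]
  exact AEMeasurable.iSup fun n => (h _).ennreal_ofReal

/-- The vector field `z ↦ K(x, z) e`. -/
def kernelField (x e : Euc d) : C(Ω, Euc d) where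
  toFun z := edKernel x z • e
  continuous_toFun := by unfold edKernel; fun_prop

/-- Expresses the field through scalar pairings, so that its size, regularity and measurability are
read off by duality. -/
theorem inner_conv (Γ : VecMeas Ω) (x e : Euc d) :
    inner ℝ e (conv Γ x) = pairing Γ (kernelField x e : C(Ω, Euc d)) := by
  have hc : Continuous fun z : Ω => edKernel x (z : Euc d) := by unfold edKernel; fun_prop
  exact map_vectorIntegral Γ (B := ContinuousLinearMap.lsmul ℝ ℝ) (B' := innerSL ℝ)
    ((ContinuousLinearMap.id ℝ ℝ).smulRight e) (innerSL ℝ e)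
    (fun r y => by
      change inner ℝ e (r • y) = inner ℝ (r • e) y
      rw [real_inner_smul_right, real_inner_smul_left])
    (integrable_continuousMap Γ ⟨_, hc⟩)

theorem conv_eq_sum (Γ : VecMeas Ω) (x : Euc d) :
    conv Γ x = ∑ i, pairing Γ (kernelField x (EuclideanSpace.basisFun (Fin d) ℝ i) : C(Ω, Euc d)) •
      EuclideanSpace.basisFun (Fin d) ℝ i := by
  simp_rw [← inner_conv]
  exact ((EuclideanSpace.basisFun (Fin d) ℝ).sum_repr' (conv Γ x)).symm

theorem norm_le_of_inner_self_le {F : Type*} [NormedAddCommGroup F] [InnerProductSpace ℝ F] {w : F}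
    {C : ℝ} (hC : 0 ≤ C) (h : inner ℝ w w ≤ C * ‖w‖) : ‖w‖ ≤ C := by
  rw [real_inner_self_eq_norm_mul_norm] at h
  rcases eq_or_ne ‖w‖ 0 with h0 | h0
  · rwa [h0]
  · exact le_of_mul_le_mul_right h (lt_of_le_of_ne (norm_nonneg _) h0.symm)

/-- Testing the difference against itself leaves the sup norm of `(K(x, ·) - K(y, ·)) e`, and the
kernel is 1-Lipschitz in its first variable. -/
theorem norm_conv_sub_le (Γ : VecMeas Ω) (x y : Euc d) :
    ‖conv Γ x - conv Γ y‖ ≤ (tvNorm Γ).toReal * ‖x - y‖ := by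
  refine norm_le_of_inner_self_le (by positivity) ?_
  set e := conv Γ x - conv Γ y with he
  have h1 : inner ℝ e (conv Γ x - conv Γ y) =
      pairing Γ (kernelField x e - kernelField y e : C(Ω, Euc d)) := by
    rw [inner_sub_right, inner_conv, inner_conv, ← pairingₗ_apply, ← pairingₗ_apply,
      ← pairingₗ_apply, map_sub]
  rw [← he] at h1
  rw [h1, mul_assoc]
  refine (pairing_le Γ _).trans (mul_le_mul_of_nonneg_left ?_ ENNReal.toReal_nonneg)
  refine (ContinuousMap.norm_le _ (by positivity)).2 fun z => ?_
  have h2 : (kernelField x e - kernelField y e : C(Ω, Euc d)) z =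
      (edKernel x z - edKernel y z) • e := (sub_smul _ _ _).symm
  rw [h2, norm_smul]
  gcongr
  rw [edKernel, edKernel, neg_sub_neg, norm_sub_rev x y, Real.norm_eq_abs]
  exact (abs_norm_sub_norm_le _ _).trans (le_of_eq (by congr 1; abel))

theorem norm_conv_le (Γ : VecMeas Ω) (x : Euc d) {R : ℝ} (hR : 0 ≤ R)
    (hΩ : ∀ z ∈ Ω, ‖z‖ ≤ R) : ‖conv Γ x‖ ≤ (tvNorm Γ).toReal * (R + ‖x‖) := by
  refine norm_le_of_inner_self_le (by positivity) ?_
  rw [inner_conv, mul_assoc]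
  refine (pairing_le Γ _).trans (mul_le_mul_of_nonneg_left ?_ ENNReal.toReal_nonneg)
  refine (ContinuousMap.norm_le _ (by positivity)).2 fun z => ?_
  change ‖edKernel x z • conv Γ x‖ ≤ _
  rw [norm_smul]
  gcongr
  rw [edKernel, norm_neg, norm_norm]
  linarith [norm_sub_le x (z : Euc d), hΩ z z.2]

end Pairing

/-! ### The Riesz theorem for signed functionals -/

section Riesz

open scoped NNReal

variable {X : Type*} [TopologicalSpace X]

/-- The positive part of a bounded functional on continuous functions, on nonnegative functions. -/
def posPartFunctional (Λ : C(X, ℝ) →L[ℝ] ℝ) (f : C(X, ℝ)) : ℝ := sSup (Λ '' Icc 0 f)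

theorem posPartFunctional_le (Λ : C(X, ℝ) →L[ℝ] ℝ) {f : C(X, ℝ)} (hf : 0 ≤ f) {b : ℝ}
    (h : ∀ g, 0 ≤ g → g ≤ f → Λ g ≤ b) : posPartFunctional Λ f ≤ b := by
  refine csSup_le ⟨_, 0, ⟨le_rfl, hf⟩, rfl⟩ ?_
  rintro _ ⟨g, hg, rfl⟩
  exact h g hg.1 hg.2

variable [CompactSpace X]

theorem bddAbove_image_Icc (Λ : C(X, ℝ) →L[ℝ] ℝ) (f : C(X, ℝ)) : BddAbove (Λ '' Icc 0 f) := by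
  refine ⟨‖Λ‖ * ‖f‖, ?_⟩
  rintro _ ⟨g, hg, rfl⟩
  refine (le_abs_self _).trans ((Λ.le_opNorm g).trans ?_)
  gcongr
  refine (ContinuousMap.norm_le _ (norm_nonneg _)).2 fun x => ?_
  have h0 : 0 ≤ g x := hg.1 x
  rw [Real.norm_eq_abs, abs_of_nonneg h0]
  exact (hg.2 x).trans ((le_abs_self _).trans (f.norm_coe_le_norm x))

theorem le_posPartFunctional (Λ : C(X, ℝ) →L[ℝ] ℝ) {f g : C(X, ℝ)} (hg : 0 ≤ g) (hgf : g ≤ f) :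
    Λ g ≤ posPartFunctional Λ f :=
  le_csSup (bddAbove_image_Icc Λ f) ⟨g, ⟨hg, hgf⟩, rfl⟩

theorem posPartFunctional_nonneg (Λ : C(X, ℝ) →L[ℝ] ℝ) {f : C(X, ℝ)} (hf : 0 ≤ f) :
    0 ≤ posPartFunctional Λ f := by
  simpa using le_posPartFunctional Λ le_rfl hf

/-- Riesz decomposition: any `0 ≤ h ≤ f + g` splits into `h ⊓ f ≤ f` and `h - h ⊓ f ≤ g`. -/
theorem posPartFunctional_add (Λ : C(X, ℝ) →L[ℝ] ℝ) {f g : C(X, ℝ)} (hf : 0 ≤ f) (hg : 0 ≤ g) :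
    posPartFunctional Λ (f + g) = posPartFunctional Λ f + posPartFunctional Λ g := by
  refine le_antisymm (posPartFunctional_le Λ (add_nonneg hf hg) fun h h0 h1 => ?_) ?_
  · have h2 : Λ h = Λ (h ⊓ f) + Λ (h - h ⊓ f) := by rw [← map_add, add_sub_cancel]
    rw [h2]
    refine add_le_add (le_posPartFunctional Λ (le_inf h0 hf) inf_le_right)
      (le_posPartFunctional Λ (sub_nonneg.2 inf_le_left) ?_)
    rw [sub_le_iff_le_add]
    intro x
    have h3 : h x ≤ f x + g x := h1 x
    have h4 : 0 ≤ g x := hg x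
    change h x ≤ g x + min (h x) (f x)
    rcases min_cases (h x) (f x) with h5 | h5 <;> linarith
  · rw [← le_sub_iff_add_le]
    refine posPartFunctional_le Λ hf fun p hp hpf => ?_
    rw [le_sub_iff_add_le, ← le_sub_iff_add_le']
    refine posPartFunctional_le Λ hg fun q hq hqg => ?_
    rw [le_sub_iff_add_le', ← map_add]
    exact le_posPartFunctional Λ (add_nonneg hp hq) (add_le_add hpf hqg)

theorem mul_posPartFunctional_le (Λ : C(X, ℝ) →L[ℝ] ℝ) {f : C(X, ℝ)} (hf : 0 ≤ f) {c : ℝ}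
    (hc : 0 < c) : c * posPartFunctional Λ f ≤ posPartFunctional Λ (c • f) := by
  rw [← le_div_iff₀' hc]
  refine posPartFunctional_le Λ hf fun g hg hgf => ?_
  rw [le_div_iff₀' hc, ← smul_eq_mul, ← map_smul]
  exact le_posPartFunctional Λ (smul_nonneg hc.le hg) (smul_le_smul_of_nonneg_left hgf hc.le)

theorem posPartFunctional_smul (Λ : C(X, ℝ) →L[ℝ] ℝ) {f : C(X, ℝ)} (hf : 0 ≤ f) {c : ℝ}
    (hc : 0 ≤ c) : posPartFunctional Λ (c • f) = c * posPartFunctional Λ f := by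
  rcases hc.eq_or_lt with rfl | hc
  · rw [zero_smul, zero_mul]
    refine le_antisymm (posPartFunctional_le Λ le_rfl fun g h0 h1 => ?_)
      (posPartFunctional_nonneg Λ le_rfl)
    rw [le_antisymm h1 h0, map_zero]
  · refine le_antisymm ?_ (mul_posPartFunctional_le Λ hf hc)
    have h := mul_posPartFunctional_le Λ (smul_nonneg hc.le hf) (inv_pos.2 hc)
    rw [smul_smul, inv_mul_cancel₀ hc.ne', one_smul] at h
    rwa [inv_mul_le_iff₀ hc] at h

variable [MeasurableSpace X] [BorelSpace X]

theorem integrable_continuousMap_of_isFiniteMeasure (μ : Measure X) [IsFiniteMeasure μ]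
    (f : C(X, ℝ)) : Integrable f μ :=
  f.continuous.integrable_of_hasCompactSupport (HasCompactSupport.of_compactSpace f)

variable [T2Space X]

/-- A positive, additive and homogeneous functional on nonnegative continuous functions is an
integral. -/
theorem exists_measure_of_nonneg_functional (F : C(X, ℝ) → ℝ) (h0 : ∀ f, 0 ≤ f → 0 ≤ F f)
    (hadd : ∀ f g, 0 ≤ f → 0 ≤ g → F (f + g) = F f + F g)
    (hsmul : ∀ (c : ℝ) f, 0 ≤ c → 0 ≤ f → F (c • f) = c * F f) :
    ∃ μ : Measure X, IsFiniteMeasure μ ∧ ∀ f, 0 ≤ f → ∫ x, f x ∂μ = F f := by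
  let r : CompactlySupportedContinuousMap X ℝ≥0 → C(X, ℝ) := fun φ =>
    ⟨fun x => (φ x : ℝ), by fun_prop⟩
  have hr : ∀ φ, 0 ≤ r φ := fun φ x => (φ x).2
  let P : CompactlySupportedContinuousMap X ℝ≥0 →ₗ[ℝ≥0] ℝ≥0 :=
    { toFun := fun φ => ⟨F (r φ), h0 _ (hr φ)⟩
      map_add' := fun φ ψ => by
        apply NNReal.eq
        change F (r (φ + ψ)) = F (r φ) + F (r ψ)
        rw [← hadd _ _ (hr φ) (hr ψ)]
        congr 1
      map_smul' := fun c φ => by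
        apply NNReal.eq
        change F (r (c • φ)) = (c : ℝ) * F (r φ)
        have h : r (c • φ) = (c : ℝ) • r φ := by
          ext x
          rfl
        rw [h]
        exact hsmul _ _ c.2 (hr φ) }
  refine ⟨NNRealRMK.rieszMeasure P, inferInstance, fun f hf => ?_⟩
  let φ : CompactlySupportedContinuousMap X ℝ≥0 :=
    ⟨⟨fun x => (f x).toNNReal, by fun_prop⟩, HasCompactSupport.of_compactSpace _⟩
  have h1 : r φ = f := by
    ext x
    exact Real.coe_toNNReal _ (hf x)
  have h2 := NNRealRMK.integral_rieszMeasure P φ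
  calc ∫ x, f x ∂(NNRealRMK.rieszMeasure P) = ∫ x, (φ x : ℝ) ∂(NNRealRMK.rieszMeasure P) := by
        rw [← h1]
        rfl
    _ = F (r φ) := h2
    _ = F f := by rw [h1]

/-- The Riesz representation theorem for bounded functionals on `C(X, ℝ)`. -/
theorem exists_measure_sub_of_functional (Λ : C(X, ℝ) →L[ℝ] ℝ) :
    ∃ μ ν : Measure X, IsFiniteMeasure μ ∧ IsFiniteMeasure ν ∧
      ∀ f : C(X, ℝ), ∫ x, f x ∂μ - ∫ x, f x ∂ν = Λ f := by
  obtain ⟨μ, hμ, h1⟩ := exists_measure_of_nonneg_functional (posPartFunctional Λ)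
    (fun f hf => posPartFunctional_nonneg Λ hf) (fun f g => posPartFunctional_add Λ)
    (fun c f hc hf => posPartFunctional_smul Λ hf hc)
  -- The negative part is `Λ⁺ - Λ`, nonnegative because `f` itself competes in the supremum defining
  -- `Λ⁺ f`.
  obtain ⟨ν, hν, h2⟩ := exists_measure_of_nonneg_functional
    (fun f => posPartFunctional Λ f - Λ f)
    (fun f hf => sub_nonneg.2 (le_posPartFunctional Λ hf le_rfl))
    (fun f g hf hg => by rw [posPartFunctional_add Λ hf hg, map_add]; ring)
    (fun c f hc hf => by rw [posPartFunctional_smul Λ hf hc, map_smul, smul_eq_mul]; ring)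
  refine ⟨μ, ν, hμ, hν, fun f => ?_⟩
  have hpos : ∀ f : C(X, ℝ), 0 ≤ f → ∫ x, f x ∂μ - ∫ x, f x ∂ν = Λ f := fun f hf => by
    rw [h1 f hf, h2 f hf]
    ring
  have hdec : ∀ (m : Measure X) [IsFiniteMeasure m],
      ∫ x, f x ∂m = ∫ x, (f ⊔ 0) x ∂m - ∫ x, (-f ⊔ 0) x ∂m := fun m _ => by
    rw [← integral_sub (integrable_continuousMap_of_isFiniteMeasure m _)
      (integrable_continuousMap_of_isFiniteMeasure m _)]
    refine integral_congr_ae (ae_of_all _ fun x => ?_)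
    change f x = max (f x) 0 - max (-f x) 0
    exact (max_zero_sub_max_neg_zero_eq_self (f x)).symm
  have hΛ : Λ f = Λ (f ⊔ 0) - Λ (-f ⊔ 0) := by
    rw [← map_sub]
    congr 1
    ext x
    exact (max_zero_sub_max_neg_zero_eq_self (f x)).symm
  rw [hdec μ, hdec ν, hΛ, ← hpos _ le_sup_right, ← hpos _ le_sup_right]
  ring

end Riesz

/-! ### The Riesz theorem for vector fields, by coordinates -/

section VectorRiesz

variable {d : ℕ} {Ω : Set (Euc d)} [CompactSpace Ω]

/-- The Riesz representation theorem for bounded functionals on `C(Ω, ℝᵈ)`. -/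
theorem exists_pairing_eq (Λ : C(Ω, Euc d) →L[ℝ] ℝ) :
    ∃ Γ : VecMeas Ω, ∀ f : C(Ω, Euc d), pairing Γ f = Λ f := by
  let ι : Fin d → ℝ →L[ℝ] Euc d := fun i =>
    (ContinuousLinearMap.id ℝ ℝ).smulRight (EuclideanSpace.basisFun (Fin d) ℝ i)
  let π : Fin d → Euc d →L[ℝ] ℝ := fun i => EuclideanSpace.proj i
  have hex := fun i => exists_measure_sub_of_functional
    (Λ.comp ((ι i).compLeftContinuous ℝ Ω))
  choose μ ν hμ hν h using hex
  let s : Fin d → SignedMeasure Ω := fun i => (μ i).toSignedMeasure - (ν i).toSignedMeasure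
  have hsf : ∀ i, IsFiniteMeasure (s i).variation := fun i => by
    rw [← SignedMeasure.totalVariation_eq_variation]
    infer_instance
  have hfin : ∀ (i : Fin d) (m : Measure Ω) [IsFiniteMeasure m] (f : C(Ω, ℝ)), Integrable f m :=
    fun i m _ f => integrable_continuousMap_of_isFiniteMeasure m f
  refine ⟨∑ i, (s i).mapRange (ι i).toLinearMap.toAddMonoidHom (ι i).continuous, fun f => ?_⟩
  have hterm : ∀ i, pairing ((s i).mapRange (ι i).toLinearMap.toAddMonoidHom (ι i).continuous) f =
      Λ ((ι i).compLeftContinuous ℝ Ω ((π i).compLeftContinuous ℝ Ω f)) := by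
    intro i
    have hf : Integrable f (s i).variation :=
      f.continuous.integrable_of_hasCompactSupport (HasCompactSupport.of_compactSpace f)
    let B' : Euc d →L[ℝ] ℝ →L[ℝ] ℝ := (ContinuousLinearMap.lsmul ℝ ℝ).flip.comp (π i)
    have h1 : pairing ((s i).mapRange (ι i).toLinearMap.toAddMonoidHom (ι i).continuous) f =
        (s i).integral f B' := by
      refine vectorIntegral_mapRange (s i) (innerSL ℝ) B' (ι i) (fun x y => ?_) hf
      change y • x i = inner ℝ x (y • EuclideanSpace.basisFun (Fin d) ℝ i)
      rw [real_inner_smul_right, EuclideanSpace.basisFun_apply, EuclideanSpace.inner_single_right]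
      simp
    have h2 : (s i).integral f B' =
        (s i).integral (fun x => π i (f x)) (ContinuousLinearMap.lsmul ℝ ℝ).flip :=
      map_vectorIntegral (s i) (π i) (ContinuousLinearMap.id ℝ ℝ) (fun x y => rfl) hf
    have hg := fun (m : Measure Ω) (_ : IsFiniteMeasure m) =>
      hfin i m ((π i).compLeftContinuous ℝ Ω f)
    rw [h1, h2, VectorMeasure.integral_sub_vectorMeasure, VectorMeasure.integral_toSignedMeasure,
      VectorMeasure.integral_toSignedMeasure]
    · exact h i ((π i).compLeftContinuous ℝ Ω f)
    · rw [VectorMeasure.Integrable, Measure.variation_toSignedMeasure]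
      exact hg _ (hμ i)
    · rw [VectorMeasure.Integrable, Measure.variation_toSignedMeasure]
      exact hg _ (hν i)
  have hsum : pairing (∑ i, (s i).mapRange (ι i).toLinearMap.toAddMonoidHom (ι i).continuous) f =
      ∑ i, pairing ((s i).mapRange (ι i).toLinearMap.toAddMonoidHom (ι i).continuous) f :=
    VectorMeasure.integral_finsetSum_vectorMeasure fun i _ => integrable_continuousMap _ f
  rw [hsum]
  simp_rw [hterm]
  rw [← map_sum]
  congr 1
  ext1 z
  rw [ContinuousMap.sum_apply]
  exact (EuclideanSpace.basisFun (Fin d) ℝ).sum_repr (f z)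

end VectorRiesz

/-! ### Weak limits along ultrafilters -/

section UltrafilterLimits

variable {ι V H : Type*} [NormedAddCommGroup V] [NormedSpace ℝ V]
  [NormedAddCommGroup H] [InnerProductSpace ℝ H] [CompleteSpace H]

/-- A family of linear functionals bounded along an ultrafilter has a bounded pointwise limit. -/
theorem exists_functional_tendsto (U : Ultrafilter ι) (p : ι → V →ₗ[ℝ] ℝ) {C : ι → ℝ} {c : ℝ}
    (hC : Tendsto C U (𝓝 c)) (h : ∀ i f, |p i f| ≤ C i * ‖f‖) :
    ∃ Λ : V →L[ℝ] ℝ, (∀ f, Tendsto (fun i => p i f) U (𝓝 (Λ f))) ∧ ∀ f, |Λ f| ≤ c * ‖f‖ := by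
  have hlim : ∀ f, ∃ y, Tendsto (fun i => p i f) U (𝓝 y) := by
    intro f
    -- The bounds `C i` are controlled only through their limit: eventually they are below `c + 1`.
    have hmem : Icc (-((c + 1) * ‖f‖)) ((c + 1) * ‖f‖) ∈ U.map (fun i => p i f) := by
      rw [Ultrafilter.mem_map]
      filter_upwards [hC.eventually_lt_const (lt_add_one c)] with i hi
      refine abs_le.1 ((h i f).trans ?_)
      gcongr
    obtain ⟨y, -, hy⟩ := isCompact_Icc.ultrafilter_le_nhds' _ hmem
    exact ⟨y, hy⟩
  choose Λ hΛ using hlim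
  have hb : ∀ f, |Λ f| ≤ c * ‖f‖ := fun f =>
    le_of_tendsto_of_tendsto' (hΛ f).abs (hC.mul_const _) fun i => h i f
  let Λₗ : V →ₗ[ℝ] ℝ :=
    { toFun := Λ
      map_add' := fun f g => by
        refine tendsto_nhds_unique (hΛ (f + g)) ?_
        simp_rw [map_add]
        exact (hΛ f).add (hΛ g)
      map_smul' := fun r f => by
        refine tendsto_nhds_unique (hΛ (r • f)) ?_
        simp_rw [map_smul]
        exact (hΛ f).const_smul r }
  exact ⟨Λₗ.mkContinuous c hb, hΛ, hb⟩

/-- Bounded families in a Hilbert space have weak limits along ultrafilters. -/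
theorem exists_weak_limit (U : Ultrafilter ι) {x : ι → H} {C : ℝ} (hx : ∀ i, ‖x i‖ ≤ C) :
    ∃ y, ∀ h, Tendsto (fun i => inner ℝ (x i) h) U (𝓝 (inner ℝ y h)) := by
  obtain ⟨Λ, hΛ, -⟩ := exists_functional_tendsto U (fun i => (innerSL ℝ (x i)).toLinearMap)
    (C := fun _ => C) tendsto_const_nhds fun i f =>
      (abs_real_inner_le_norm _ _).trans (mul_le_mul_of_nonneg_right (hx i) (norm_nonneg f))
  refine ⟨(InnerProductSpace.toDual ℝ H).symm Λ, fun h => ?_⟩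
  rw [InnerProductSpace.toDual_symm_apply]
  exact hΛ h

/-- One ultrafilter serves all `f` at once, so uniqueness of limits makes the limit linear in `f`.
-/
theorem exists_linear_weak_limit (U : Ultrafilter ι) (p : ι → V →ₗ[ℝ] H) {C : ℝ}
    (hp : ∀ i f, ‖p i f‖ ≤ C * ‖f‖) :
    ∃ W : V →ₗ[ℝ] H, ∀ f h, Tendsto (fun i => inner ℝ (p i f) h) U (𝓝 (inner ℝ (W f) h)) := by
  choose W hW using fun f => exists_weak_limit U (x := fun i => p i f) fun i => hp i f
  refine ⟨{ toFun := W, map_add' := fun f g => ?_, map_smul' := fun r f => ?_ }, hW⟩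
  · refine ext_inner_right ℝ fun h => tendsto_nhds_unique (hW (f + g) h) ?_
    simp_rw [map_add, inner_add_left]
    exact (hW f h).add (hW g h)
  · refine ext_inner_right ℝ fun h => tendsto_nhds_unique (hW (r • f) h) ?_
    simp_rw [map_smul, RingHom.id_apply, real_inner_smul_left]
    exact (hW f h).const_mul r

end UltrafilterLimits

/-! ### Pointwise functionals from a dominated map into `L²` -/

section Disintegration

variable {V : Type*} [NormedAddCommGroup V] [NormedSpace ℝ V]

theorem integrable_Lp_two {α : Type*} [MeasurableSpace α] {μ : Measure α} [IsFiniteMeasure μ]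
    (u : Lp ℝ 2 μ) : Integrable u μ :=
  (Lp.memLp u).integrable (by norm_num)

/-- The average over a set, as a linear functional on `L²`. -/
def averageₗ {α : Type*} [MeasurableSpace α] (μ : Measure α) [IsFiniteMeasure μ] (s : Set α) :
    Lp ℝ 2 μ →ₗ[ℝ] ℝ where
  toFun u := ⨍ t in s, u t ∂μ
  map_add' u w := by
    simp only [setAverage_eq]
    rw [← smul_add, ← integral_add (integrable_Lp_two u).integrableOn
      (integrable_Lp_two w).integrableOn]
    congr 1
    exact integral_congr_ae (ae_restrict_of_ae (Lp.coeFn_add u w))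
  map_smul' r u := by
    simp only [setAverage_eq, RingHom.id_apply]
    rw [smul_comm r]
    congr 1
    rw [← integral_smul]
    exact integral_congr_ae (ae_restrict_of_ae (Lp.coeFn_smul r u))

/-- A linear map into `L²` dominated by `b ‖f‖` is given by a measurable family of bounded linear
functionals. -/
theorem exists_disintegration (W : V →ₗ[ℝ] Lp ℝ 2 timeMeasure) (b : Lp ℝ 2 timeMeasure)
    (h : ∀ f, ∀ᵐ t ∂timeMeasure, |W f t| ≤ b t * ‖f‖) :
    ∃ Λ : ℝ → V →L[ℝ] ℝ, (∀ f, ∀ᵐ t ∂timeMeasure, Λ t f = W f t) ∧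
      ∀ᵐ t ∂timeMeasure, ∀ f, |Λ t f| ≤ b t * ‖f‖ := by
  -- The differentiation null set of `W f` depends on `f`. Limits of averages along an ultrafilter
  -- finer than `v.filterAt t` exist for all `f` at once wherever the averages of `b` converge; they
  -- equal `W f t` for almost every `t`, each `f` being fixed.
  let v := Besicovitch.vitaliFamily timeMeasure
  have hex : ∀ t, ∃ Λ : V →L[ℝ] ℝ,
      Tendsto (fun s => ⨍ r in s, b r ∂timeMeasure) (v.filterAt t) (𝓝 (b t)) →
      (∀ f, Tendsto (fun s => averageₗ timeMeasure s (W f)) (Ultrafilter.of (v.filterAt t))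
        (𝓝 (Λ f))) ∧ ∀ f, |Λ f| ≤ b t * ‖f‖ := by
    intro t
    by_cases ht : Tendsto (fun s => ⨍ r in s, b r ∂timeMeasure) (v.filterAt t) (𝓝 (b t))
    · obtain ⟨Λ, h1, h2⟩ := exists_functional_tendsto (Ultrafilter.of (v.filterAt t))
        (fun s => (averageₗ timeMeasure s).comp W)
        (ht.mono_left (Ultrafilter.of_le _)) fun s f => by
          change |⨍ r in s, W f r ∂timeMeasure| ≤ (⨍ r in s, b r ∂timeMeasure) * ‖f‖
          rw [setAverage_eq, setAverage_eq, smul_eq_mul, smul_eq_mul, abs_mul,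
            abs_of_nonneg (by positivity), mul_assoc, ← integral_mul_const]
          gcongr
          exact norm_integral_le_of_norm_le
            ((integrable_Lp_two b).mul_const ‖f‖).integrableOn 
            (ae_restrict_of_ae (p := fun t => ‖W f t‖ ≤ b t * ‖f‖) (h f))
      exact ⟨Λ, fun _ => ⟨h1, h2⟩⟩
    · exact ⟨0, fun h => absurd h ht⟩
  choose Λ hΛ using hex
  have hb := v.ae_tendsto_average (integrable_Lp_two b).locallyIntegrable
  refine ⟨Λ, fun f => ?_, ?_⟩
  · filter_upwards [hb, v.ae_tendsto_average (integrable_Lp_two (W f)).locallyIntegrable]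
      with t ht hf
    exact tendsto_nhds_unique ((hΛ t ht).1 f) (hf.mono_left (Ultrafilter.of_le _))
  · filter_upwards [hb] with t ht
    exact (hΛ t ht).2

end Disintegration

/-! ### Weak-* compactness of curves of measures -/

section WeakCompactness

theorem norm_sq_Lp_two {α : Type*} [MeasurableSpace α] {μ : Measure α} (u : Lp ℝ 2 μ) :
    ENNReal.ofReal (‖u‖ ^ 2) = ∫⁻ t, ENNReal.ofReal |u t| ^ 2 ∂μ := by
  rw [← real_inner_self_eq_norm_sq, L2.inner_def, ofReal_integral_eq_lintegral_ofReal
    (L2.integrable_inner u u) (ae_of_all _ fun t => real_inner_self_nonneg)]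
  refine lintegral_congr fun t => ?_
  rw [real_inner_self_eq_norm_sq, Real.norm_eq_abs, ENNReal.ofReal_pow (abs_nonneg _)]

variable {d : ℕ} {Ω : Set (Euc d)}

namespace L2Curve

/-- The total variation of a curve of measures, as a real function of time. -/
def tv (Γ : L2Curve Ω) (t : ℝ) : ℝ := (tvNorm (Γ.toFun t)).toReal

theorem ofReal_tv (Γ : L2Curve Ω) (t : ℝ) : ENNReal.ofReal (Γ.tv t) = tvNorm (Γ.toFun t) :=
  ENNReal.ofReal_toReal (tvNorm_lt_top _).ne

theorem tv_nonneg (Γ : L2Curve Ω) (t : ℝ) : 0 ≤ Γ.tv t := ENNReal.toReal_nonneg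

variable [CompactSpace Ω]

theorem aemeasurable_tvNorm (Γ : L2Curve Ω) :
    AEMeasurable (fun t => tvNorm (Γ.toFun t)) timeMeasure :=
  TVMatching.aemeasurable_tvNorm Γ.weakStar_measurable

theorem memLp_tv (Γ : L2Curve Ω) : MemLp Γ.tv 2 timeMeasure := by
  have hm : AEMeasurable Γ.tv timeMeasure := Γ.aemeasurable_tvNorm.ennreal_toReal
  refine (memLp_two_iff_integrable_sq hm.aestronglyMeasurable).2
    ⟨(hm.pow_const 2).aestronglyMeasurable, ?_⟩
  refine lt_of_eq_of_lt (lintegral_congr fun t => ?_) Γ.sq_integrable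
  rw [Real.enorm_of_nonneg (sq_nonneg _), ENNReal.ofReal_pow (Γ.tv_nonneg t), ofReal_tv]

/-- The total variation of a curve of measures, as an element of `L²`. -/
def tvLp (Γ : L2Curve Ω) : Lp ℝ 2 timeMeasure := Γ.memLp_tv.toLp Γ.tv

theorem ofReal_norm_sq_tvLp (Γ : L2Curve Ω) :
    ENNReal.ofReal (‖Γ.tvLp‖ ^ 2) = ∫⁻ t in Icc (0 : ℝ) 1, tvNorm (Γ.toFun t) ^ 2 := by
  rw [norm_sq_Lp_two]
  refine lintegral_congr_ae ?_
  filter_upwards [Γ.memLp_tv.coeFn_toLp] with t ht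
  rw [tvLp, ht, abs_of_nonneg (Γ.tv_nonneg t), ofReal_tv]

theorem memLp_pairing (Γ : L2Curve Ω) (f : C(Ω, Euc d)) :
    MemLp (fun t => pairing (Γ.toFun t) f) 2 timeMeasure :=
  (Γ.memLp_tv.mul_const ‖f‖).mono' (Γ.weakStar_measurable f).aestronglyMeasurable
    (ae_of_all _ fun _ => abs_pairing_le _ f)

/-- The pairing of a curve of measures with constant-in-time test functions, with values in
`L²`. -/
def pairingLp (Γ : L2Curve Ω) : C(Ω, Euc d) →ₗ[ℝ] Lp ℝ 2 timeMeasure where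
  toFun f := (Γ.memLp_pairing f).toLp _
  map_add' f g := by
    rw [← MemLp.toLp_add]
    refine MemLp.toLp_congr _ _ (ae_of_all _ fun t => (pairingₗ (Γ.toFun t)).map_add f g)
  map_smul' r f := by
    rw [RingHom.id_apply, ← MemLp.toLp_const_smul]
    refine MemLp.toLp_congr _ _ (ae_of_all _ fun t => (pairingₗ (Γ.toFun t)).map_smul r f)

theorem pairingLp_ae_eq (Γ : L2Curve Ω) (f : C(Ω, Euc d)) :
    Γ.pairingLp f =ᵐ[timeMeasure] fun t => pairing (Γ.toFun t) f :=
  (Γ.memLp_pairing f).coeFn_toLp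

theorem abs_pairingLp_le (Γ : L2Curve Ω) (f : C(Ω, Euc d)) :
    ∀ᵐ t ∂timeMeasure, |Γ.pairingLp f t| ≤ ‖f‖ * Γ.tvLp t := by
  filter_upwards [Γ.pairingLp_ae_eq f, Γ.memLp_tv.coeFn_toLp] with t h1 h2
  rw [h1, tvLp, h2, mul_comm]
  exact abs_pairing_le _ f

theorem norm_pairingLp_le (Γ : L2Curve Ω) (f : C(Ω, Euc d)) :
    ‖Γ.pairingLp f‖ ≤ ‖Γ.tvLp‖ * ‖f‖ := by
  rw [mul_comm]
  refine Lp.norm_le_mul_norm_of_ae_le_mul ?_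
  filter_upwards [Γ.abs_pairingLp_le f] with t h1
  refine h1.trans (mul_le_mul_of_nonneg_left (le_abs_self _) (norm_nonneg f))

end L2Curve

theorem inner_indicator_eq (u : Lp ℝ 2 timeMeasure) {A : Set ℝ} (hA : MeasurableSet A) :
    inner ℝ u (indicatorConstLp 2 hA (measure_ne_top timeMeasure A) (1 : ℝ)) =
      ∫ t in A, u t ∂timeMeasure := by
  rw [real_inner_comm]
  exact L2.inner_indicatorConstLp_one hA _ u

variable {ι : Type*} [CompactSpace Ω]

/-- Weak-* compactness of bounded sets of curves of measures, along an ultrafilter, and weak-*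
lower semicontinuity of the norm. -/
theorem exists_weakStar_limit (U : Ultrafilter ι) (Γ : ι → L2Curve Ω) {M : ℝ}
    (hM : ∀ n, ‖(Γ n).tvLp‖ ≤ M) :
    ∃ Γ' : L2Curve Ω,
      (∀ (f : C(Ω, Euc d)) A, MeasurableSet A →
        Tendsto (fun n => ∫ t in A, pairing ((Γ n).toFun t) f ∂timeMeasure) U
          (𝓝 (∫ t in A, pairing (Γ'.toFun t) f ∂timeMeasure))) ∧
      ∀ ℓ, Tendsto (fun n => ∫⁻ t in Icc (0 : ℝ) 1, tvNorm ((Γ n).toFun t) ^ 2) U (𝓝 ℓ) →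
        ∫⁻ t in Icc (0 : ℝ) 1, tvNorm (Γ'.toFun t) ^ 2 ≤ ℓ := by
  obtain ⟨b, hb⟩ := exists_weak_limit U hM
  obtain ⟨W, hW⟩ := exists_linear_weak_limit U (fun n => (Γ n).pairingLp) (C := M) fun n f =>
    ((Γ n).norm_pairingLp_le f).trans (mul_le_mul_of_nonneg_right (hM n) (norm_nonneg f))
  -- Weak limits preserve almost everywhere inequalities, as seen by testing on indicators.
  have hWle : ∀ f, ∀ᵐ t ∂timeMeasure, W f t ≤ ‖f‖ * b t := by
    intro f
    refine ae_le_of_forall_setIntegral_le (integrable_Lp_two _)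
      ((integrable_Lp_two b).const_mul _) fun A hA _ => ?_
    rw [integral_const_mul, ← inner_indicator_eq _ hA, ← inner_indicator_eq _ hA]
    refine le_of_tendsto_of_tendsto' (hW f _) ((hb _).const_mul ‖f‖) fun n => ?_
    rw [inner_indicator_eq _ hA, inner_indicator_eq _ hA, ← integral_const_mul]
    refine integral_mono_ae (integrable_Lp_two _).integrableOn
      ((integrable_Lp_two _).const_mul _).integrableOn (ae_restrict_of_ae ?_)
    filter_upwards [(Γ n).abs_pairingLp_le f] with t ht using (le_abs_self _).trans ht
  have hWabs : ∀ f, ∀ᵐ t ∂timeMeasure, |W f t| ≤ b t * ‖f‖ := by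
    intro f
    have hneg : W (-f) =ᵐ[timeMeasure] -W f := by
      rw [map_neg]
      exact Lp.coeFn_neg _
    filter_upwards [hWle f, hWle (-f), hneg] with t h1 h2 h3
    rw [h3, norm_neg, Pi.neg_apply] at h2
    exact abs_le.2 ⟨by linarith, by linarith⟩
  obtain ⟨Λ, hΛ, hΛb⟩ := exists_disintegration W b hWabs
  choose G hG using fun t => exists_pairing_eq (Λ t)
  have hGW : ∀ f : C(Ω, Euc d), (fun t => pairing (G t) f) =ᵐ[timeMeasure] W f := fun f => by
    filter_upwards [hΛ f] with t ht
    rw [hG, ht]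
  have hGb : ∫⁻ t in Icc (0 : ℝ) 1, tvNorm (G t) ^ 2 ≤ ENNReal.ofReal (‖b‖ ^ 2) := by
    rw [norm_sq_Lp_two]
    refine lintegral_mono_ae ?_
    filter_upwards [hΛb] with t ht
    gcongr
    refine tvNorm_le_of_forall (abs_nonneg _) fun f => ?_
    rw [hG]
    exact (le_abs_self _).trans ((ht f).trans
      (mul_le_mul_of_nonneg_right (le_abs_self _) (norm_nonneg f)))
  refine ⟨⟨G, fun f => ?_, hGb.trans_lt ENNReal.ofReal_lt_top⟩, fun f A hA => ?_, fun ℓ hℓ => ?_⟩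
  · exact (Lp.aestronglyMeasurable (W f)).aemeasurable.congr (hGW f).symm
  · have h1 := hW f (indicatorConstLp 2 hA (measure_ne_top timeMeasure A) (1 : ℝ))
    simp_rw [inner_indicator_eq _ hA] at h1
    rw [integral_congr_ae (ae_restrict_of_ae (hGW f))]
    refine h1.congr fun n => ?_
    exact integral_congr_ae (ae_restrict_of_ae ((Γ n).pairingLp_ae_eq f))
  · refine hGb.trans ?_
    -- Lower semicontinuity of the norm through `‖x‖² ≥ 2⟨x, b⟩ - ‖b‖²`, whose right side converges
    -- to `‖b‖²` by weak convergence.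
    have h1 : Tendsto (fun n => ENNReal.ofReal (2 * inner ℝ (Γ n).tvLp b - ‖b‖ ^ 2)) U
        (𝓝 (ENNReal.ofReal (‖b‖ ^ 2))) := by
      have h2 := ((hb b).const_mul 2).sub_const (‖b‖ ^ 2)
      rw [real_inner_self_eq_norm_sq] at h2
      have h3 : 2 * ‖b‖ ^ 2 - ‖b‖ ^ 2 = ‖b‖ ^ 2 := by ring
      rw [h3] at h2
      exact ENNReal.tendsto_ofReal h2
    refine le_of_tendsto_of_tendsto' h1 hℓ fun n => ?_
    rw [← L2Curve.ofReal_norm_sq_tvLp]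
    refine ENNReal.ofReal_le_ofReal ?_
    have h4 := norm_sub_sq_real (Γ n).tvLp b
    nlinarith [sq_nonneg ‖(Γ n).tvLp - b‖]

end WeakCompactness

/-! ### Convergence of push-forwards -/

section Pushforward

variable {d : ℕ} {Ω : Set (Euc d)} {ι : Type*} {U : Filter ι}

theorem pushforward_toMeasure {T : Euc d → Euc d} (hT : Continuous T)
    (μ : ProbabilityMeasure (Euc d)) :
    pushforward T μ = μ.map hT.measurable.aemeasurable :=
  dif_pos hT.measurable.aemeasurable

theorem integral_pushforward {T : Euc d → Euc d} (hT : Continuous T)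
    (μ : ProbabilityMeasure (Euc d)) (φ : BoundedContinuousFunction (Euc d) ℝ) :
    ∫ x, φ x ∂(pushforward T μ : Measure (Euc d)) = ∫ x, φ (T x) ∂(μ : Measure (Euc d)) := by
  rw [pushforward_toMeasure hT]
  exact integral_map hT.measurable.aemeasurable φ.continuous.aestronglyMeasurable

theorem pushforward_apply_eq_one {T : Euc d → Euc d} (hT : Continuous T)
    {μ : ProbabilityMeasure (Euc d)} (hμ : μ Ω = 1) {C : Set (Euc d)} (hC : MeasurableSet C)
    (hTC : MapsTo T Ω C) : pushforward T μ C = 1 := by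
  rw [pushforward_toMeasure hT, ProbabilityMeasure.map_apply _ _ hC]
  exact le_antisymm (ProbabilityMeasure.apply_le_one _ _)
    (hμ.ge.trans (ProbabilityMeasure.apply_mono _ hTC))

/-- Dominated convergence may fail along an ultrafilter, so convergence is kept uniform on `Ω`: a
test function is uniformly continuous on `C`, and `μ` is concentrated on `Ω`. -/
theorem tendsto_pushforward (hΩ : MeasurableSet Ω) {μ : ProbabilityMeasure (Euc d)} (hμ : μ Ω = 1)
    {T : ι → Euc d → Euc d} {T' : Euc d → Euc d} (hT : ∀ n, Continuous (T n)) (hT' : Continuous T')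
    {C : Set (Euc d)} (hC : IsCompact C) (hTC : ∀ n, MapsTo (T n) Ω C) (hTC' : MapsTo T' Ω C)
    (h : TendstoUniformly (fun n (z : Ω) => T n z) (fun z : Ω => T' z) U) :
    Tendsto (fun n => pushforward (T n) μ) U (𝓝 (pushforward T' μ)) := by
  rw [ProbabilityMeasure.tendsto_iff_forall_integral_tendsto]
  intro φ
  simp_rw [integral_pushforward (hT _), integral_pushforward hT']
  have hφ := (hC.uniformContinuousOn_of_continuous φ.continuous.continuousOn).comp_tendstoUniformly
    (fun n z => hTC n z.2) (fun z => hTC' z.2) h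
  have hae : ∀ᵐ x ∂(μ : Measure (Euc d)), x ∈ Ω := by
    refine (prob_compl_eq_zero_iff hΩ).2 ?_
    rw [← ProbabilityMeasure.ennreal_coeFn_eq_coeFn_toMeasure, hμ, ENNReal.coe_one]
  have hint : ∀ {S : Euc d → Euc d}, Continuous S →
      Integrable (fun x => φ (S x)) (μ : Measure (Euc d)) := fun hS =>
    Integrable.of_bound (φ.continuous.comp hS).aestronglyMeasurable ‖φ‖
      (ae_of_all _ fun x => φ.norm_coe_le_norm _)
  rw [Metric.tendsto_nhds]
  intro ε hε
  filter_upwards [Metric.tendstoUniformly_iff.1 hφ (ε / 2) (by positivity)] with n hn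
  rw [dist_eq_norm, ← integral_sub (hint (hT n)) (hint hT')]
  have h1 := norm_integral_le_of_norm_le_const (μ := (μ : Measure (Euc d))) (C := ε / 2)
    (f := fun x => φ (T n x) - φ (T' x)) (by
      filter_upwards [hae] with x hx
      rw [← dist_eq_norm, dist_comm]
      exact (hn ⟨x, hx⟩).le)
  simp only [probReal_univ, mul_one] at h1
  linarith

end Pushforward

/-! ### Flows generated by curves of measures -/

section Flow

variable {d : ℕ} {Ω : Set (Euc d)} [CompactSpace Ω] {R M : ℝ}

theorem isCaratheodory_conv (Γ : L2Curve Ω) (hR : 0 ≤ R) (hΩ : ∀ z ∈ Ω, ‖z‖ ≤ R) :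
    IsCaratheodory (fun s => conv (Γ.toFun s)) Γ.tv R where
  meas x := by
    simp_rw [conv_eq_sum]
    exact Finset.aestronglyMeasurable_fun_sum _ fun i _ =>
      (Γ.weakStar_measurable _).aestronglyMeasurable.smul_const _
  lip _ x y := norm_conv_sub_le _ x y
  growth _ x := norm_conv_le _ x hR hΩ
  coeff_nonneg := Γ.tv_nonneg
  radius_nonneg := hR
  memLp := Γ.memLp_tv

theorem exists_radius : ∃ R : ℝ, 0 ≤ R ∧ ∀ z ∈ Ω, ‖z‖ ≤ R := by
  obtain ⟨R, hR⟩ := (isCompact_iff_compactSpace.2 ‹CompactSpace Ω›).isBounded.exists_norm_le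
  exact ⟨max R 0, le_max_right _ _, fun z hz => (hR z hz).trans (le_max_left _ _)⟩

theorem isFlow_flow (Γ : L2Curve Ω) : IsFlow Γ (flow Γ) := by
  obtain ⟨R, hR, hΩ⟩ := exists_radius (Ω := Ω)
  choose u hu using (isCaratheodory_conv Γ hR hΩ).exists_isIntegralCurveFrom
  -- The chosen `flow` is known to be a flow only once some flow is exhibited.
  exact Classical.epsilon_spec (p := IsFlow Γ) ⟨fun t x => u x t, hu⟩

theorem IsFlow.eq_flow {Γ : L2Curve Ω} {ψ : ℝ → Euc d → Euc d} (hψ : IsFlow Γ ψ) {t : ℝ}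
    (ht : t ∈ Icc (0 : ℝ) 1) : ψ t = flow Γ t := by
  obtain ⟨R, hR, hΩ⟩ := exists_radius (Ω := Ω)
  funext x
  exact (isCaratheodory_conv Γ hR hΩ).eq_of_isIntegralCurveFrom (hψ x) (isFlow_flow Γ x) ht

theorem isBiLipschitzHomeo_flow (Γ : L2Curve Ω) : IsBiLipschitzHomeo (flow Γ 1) := by
  obtain ⟨R, hR, hΩ⟩ := exists_radius (Ω := Ω)
  exact (isCaratheodory_conv Γ hR hΩ).exists_homeomorph fun x => ⟨_, isFlow_flow Γ x, rfl⟩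

theorem continuous_flow_one (Γ : L2Curve Ω) : Continuous (flow Γ 1) := by
  obtain ⟨h, hT, -⟩ := isBiLipschitzHomeo_flow Γ
  have : flow Γ 1 = h := (funext hT).symm
  rw [this]
  exact h.continuous

theorem integral_sq_tv (Γ : L2Curve Ω) : ∫ t, Γ.tv t ^ 2 ∂timeMeasure = ‖Γ.tvLp‖ ^ 2 := by
  rw [← real_inner_self_eq_norm_sq, L2.inner_def]
  refine integral_congr_ae ?_
  filter_upwards [Γ.memLp_tv.coeFn_toLp] with t ht
  rw [L2Curve.tvLp, ht, real_inner_self_eq_norm_sq, Real.norm_eq_abs, sq_abs]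

theorem dist_flow_one_le (Γ : L2Curve Ω) (hM : ∫ t, Γ.tv t ^ 2 ∂timeMeasure ≤ M) (x y : Euc d) :
    dist (flow Γ 1 x) (flow Γ 1 y) ≤ 2 * dist x y * Real.exp M := by
  obtain ⟨R, hR, hΩ⟩ := exists_radius (Ω := Ω)
  rw [dist_eq_norm, dist_eq_norm]
  exact (isCaratheodory_conv Γ hR hΩ).norm_sub_le hM (isFlow_flow Γ x) (isFlow_flow Γ y)
    ⟨zero_le_one, le_rfl⟩

theorem norm_flow_one_le (Γ : L2Curve Ω) (hM : ∫ t, Γ.tv t ^ 2 ∂timeMeasure ≤ M) (hR : 0 ≤ R)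
    (hΩ : ∀ z ∈ Ω, ‖z‖ ≤ R) {x : Euc d} (hx : x ∈ Ω) :
    ‖flow Γ 1 x‖ ≤ 4 * R * Real.exp M := by
  have h := (isCaratheodory_conv Γ hR hΩ).norm_add_radius_le hM (isFlow_flow Γ x)
    ⟨zero_le_one, le_rfl⟩
  have h1 : 2 * (R + ‖x‖) * Real.exp M ≤ 2 * (R + R) * Real.exp M := by
    gcongr
    exact hΩ x hx
  linarith

variable {ι : Type*} {U : Filter ι} {Γ : ι → L2Curve Ω} {Γ' : L2Curve Ω}

/-- Weak-* convergence of curves of measures implies convergence of the flows. -/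
theorem tendsto_flow_one (hM : ∀ n, ∫ t, (Γ n).tv t ^ 2 ∂timeMeasure ≤ M)
    (hM' : ∫ t, Γ'.tv t ^ 2 ∂timeMeasure ≤ M)
    (h : ∀ (f : C(Ω, Euc d)) A, MeasurableSet A →
      Tendsto (fun n => ∫ t in A, pairing ((Γ n).toFun t) f ∂timeMeasure) U
        (𝓝 (∫ t in A, pairing (Γ'.toFun t) f ∂timeMeasure))) (x : Euc d) :
    Tendsto (fun n => flow (Γ n) 1 x) U (𝓝 (flow Γ' 1 x)) := by
  obtain ⟨R, hR, hΩ⟩ := exists_radius (Ω := Ω)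
  refine IsCaratheodory.tendsto_integralCurve (fun n => isCaratheodory_conv (Γ n) hR hΩ) hM
    (isCaratheodory_conv Γ' hR hΩ) hM' (fun c A hA => ?_) (isFlow_flow Γ' x)
    fun n => isFlow_flow (Γ n) x
  -- Weak-* convergence is tested on scalar pairings, so the field is expanded in coordinates.
  have hsum : ∀ Γ : L2Curve Ω, ∫ s in A, conv (Γ.toFun s) c ∂timeMeasure =
      ∑ i, (∫ s in A, pairing (Γ.toFun s)
        (kernelField c (EuclideanSpace.basisFun (Fin d) ℝ i) : C(Ω, Euc d)) ∂timeMeasure) •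
        EuclideanSpace.basisFun (Fin d) ℝ i := by
    intro Γ
    simp_rw [conv_eq_sum]
    rw [integral_finsetSum]
    · exact Finset.sum_congr rfl fun i _ => integral_smul_const _ _
    · exact fun i _ => (((Γ.memLp_pairing _).integrable (by norm_num)).smul_const _).integrableOn
  simp_rw [hsum]
  exact tendsto_finsetSum _ fun i _ => (h _ A hA).smul_const _

theorem tendstoUniformly_flow_one (hM : ∀ n, ∫ t, (Γ n).tv t ^ 2 ∂timeMeasure ≤ M)
    (h : ∀ x, Tendsto (fun n => flow (Γ n) 1 x) U (𝓝 (flow Γ' 1 x))) :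
    TendstoUniformly (fun n (z : Ω) => flow (Γ n) 1 z) (fun z : Ω => flow Γ' 1 z) U := by
  have hequi : Equicontinuous fun n (z : Ω) => flow (Γ n) 1 z := by
    refine Metric.equicontinuous_of_continuity_modulus (fun r => 2 * r * Real.exp M) ?_ _
      fun x y n => dist_flow_one_le (Γ n) (hM n) x y
    have : Continuous fun r => 2 * r * Real.exp M := by fun_prop
    simpa using this.tendsto 0
  refine UniformFun.tendsto_iff_tendstoUniformly.1 ((hequi.tendsto_uniformFun_iff_pi U _).2 ?_)
  exact tendsto_pi_nhds.2 fun z => h z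

end Flow

/-! ### The direct method -/

section Minimizer

variable {d : ℕ} {Ω : Set (Euc d)}

instance : Nonempty (L2Curve Ω) := by
  have h0 : ∀ f : Ω → Euc d, pairing (0 : VecMeas Ω) f = 0 := fun f =>
    VectorMeasure.integral_zero_vectorMeasure
  have h1 : tvNorm (0 : VecMeas Ω) = 0 := by simp [tvNorm, h0]
  exact ⟨⟨fun _ => 0, fun f => by simp [h0], by simp [h1]⟩⟩

theorem exists_isMinimizer (hΩ : IsCompact Ω) {μ₀ ν : ProbabilityMeasure (Euc d)}
    (hμ₀ : μ₀ Ω = 1) {L : ProbabilityMeasure (Euc d) → ProbabilityMeasure (Euc d) → ℝ≥0∞}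
    (hL : WeakStarLSC (fun μ => L μ ν)) {β : ℝ} (hβ : 0 < β) :
    ∃ Γ : L2Curve Ω, IsMinimizer L μ₀ ν β Γ := by
  have : CompactSpace Ω := isCompact_iff_compactSpace.1 hΩ
  set I := ⨅ Γ : L2Curve Ω, energy L μ₀ ν β Γ with hI
  -- If the infimum is infinite, every curve is a minimizer.
  rcases eq_or_ne I ∞ with hItop | hItop
  · obtain ⟨Γ⟩ : Nonempty (L2Curve Ω) := inferInstance
    refine ⟨Γ, fun Γ' => le_top.trans ?_⟩
    rw [← hItop]
    exact iInf_le _ Γ'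
  have hseq : ∀ n : ℕ, ∃ Γ : L2Curve Ω, energy L μ₀ ν β Γ < I + ((n : ℝ≥0∞) + 1)⁻¹ := fun n =>
    iInf_lt_iff.1 (ENNReal.lt_add_right hItop (by simp))
  choose Γ hΓ using hseq
  have hlim : Tendsto (fun n => energy L μ₀ ν β (Γ n)) atTop (𝓝 I) := by
    refine tendsto_of_tendsto_of_tendsto_of_le_of_le tendsto_const_nhds ?_
      (fun n => iInf_le _ (Γ n)) fun n => (hΓ n).le
    have h1 : Tendsto (fun n : ℕ => ((n : ℝ≥0∞) + 1)⁻¹) atTop (𝓝 0) := by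
      have := (tendsto_add_atTop_iff_nat 1).2 ENNReal.tendsto_inv_nat_nhds_zero
      simpa using this
    simpa using tendsto_const_nhds.add h1
  have hβ0 : ENNReal.ofReal β ≠ 0 := (ENNReal.ofReal_pos.2 hβ).ne'
  set K := (I + 1) / ENNReal.ofReal β with hK
  have hKtop : K ≠ ∞ := ENNReal.div_ne_top (by finiteness) hβ0
  have hbound : ∀ n, ∫⁻ t in Icc (0 : ℝ) 1, tvNorm ((Γ n).toFun t) ^ 2 ≤ K := by
    intro n
    rw [hK, ENNReal.le_div_iff_mul_le (Or.inl hβ0) (Or.inl ENNReal.ofReal_ne_top), mul_comm]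
    refine le_add_self.trans ((hΓ n).le.trans ?_)
    gcongr
    simp
  have hnorm : ∀ n, ‖(Γ n).tvLp‖ ^ 2 ≤ K.toReal := fun n => by
    rw [← ENNReal.ofReal_le_iff_le_toReal hKtop, L2Curve.ofReal_norm_sq_tvLp]
    exact hbound n
  let U : Ultrafilter ℕ := hyperfilter ℕ
  have hU : (U : Filter ℕ) ≤ atTop := Nat.hyperfilter_le_atTop
  obtain ⟨Γ', hweak, hlsc⟩ := exists_weakStar_limit U Γ (M := Real.sqrt K.toReal) fun n =>
    Real.le_sqrt_of_sq_le (hnorm n)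
  obtain ⟨R, hR, hΩR⟩ := exists_radius (Ω := Ω)
  -- Including the limit curve lets one constant control all the flows and one ball contain all the
  -- images of `Ω`.
  set M := max K.toReal (∫ t, Γ'.tv t ^ 2 ∂timeMeasure)
  have hM : ∀ n, ∫ t, (Γ n).tv t ^ 2 ∂timeMeasure ≤ M := fun n => by
    rw [integral_sq_tv]
    exact (hnorm n).trans (le_max_left _ _)
  have hM' : ∫ t, Γ'.tv t ^ 2 ∂timeMeasure ≤ M := le_max_right _ _
  set C : Set (Euc d) := Metric.closedBall 0 (4 * R * Real.exp M)
  have hC : IsCompact C := isCompact_closedBall _ _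
  have hmaps : ∀ Γ : L2Curve Ω, ∫ t, Γ.tv t ^ 2 ∂timeMeasure ≤ M → MapsTo (flow Γ 1) Ω C :=
    fun Γ h x hx => mem_closedBall_zero_iff.2 (norm_flow_one_le Γ h hR hΩR hx)
  have hpush : Tendsto (fun n => pushforward (flow (Γ n) 1) μ₀) U
      (𝓝 (pushforward (flow Γ' 1) μ₀)) :=
    tendsto_pushforward hΩ.measurableSet hμ₀ (fun n => continuous_flow_one (Γ n))
      (continuous_flow_one Γ') hC (fun n => hmaps _ (hM n)) (hmaps _ hM')
      (tendstoUniformly_flow_one hM fun x => tendsto_flow_one hM hM' hweak x)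
  have hcarried : ∀ Γ : L2Curve Ω, ∫ t, Γ.tv t ^ 2 ∂timeMeasure ≤ M →
      pushforward (flow Γ 1) μ₀ C = 1 := fun Γ h =>
    pushforward_apply_eq_one (continuous_flow_one Γ) hμ₀ hC.measurableSet (hmaps Γ h)
  have hexlim : ∀ F : ℕ → ℝ≥0∞, ∃ ℓ, Tendsto F U (𝓝 ℓ) := fun F =>
    ⟨(U.map F).lim, (U.map F).le_nhds_lim⟩
  obtain ⟨ℓ₁, hℓ₁⟩ := hexlim fun n => L (pushforward (flow (Γ n) 1) μ₀) ν
  obtain ⟨ℓ₂, hℓ₂⟩ := hexlim fun n => ∫⁻ t in Icc (0 : ℝ) 1, tvNorm ((Γ n).toFun t) ^ 2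
  have hL1 : L (pushforward (flow Γ' 1) μ₀) ν ≤ ℓ₁ := by
    refine le_of_forall_lt_imp_le_of_dense fun y hy => ?_
    refine ge_of_tendsto hℓ₁ ?_
    -- Lower semicontinuity is available only among measures carried by `C`, so convergence is taken
    -- within that set.
    have h1 : Tendsto (fun n => pushforward (flow (Γ n) 1) μ₀) U
        (𝓝[{μ | μ C = 1}] (pushforward (flow Γ' 1) μ₀)) :=
      tendsto_nhdsWithin_iff.2 ⟨hpush, Eventually.of_forall fun n => hcarried _ (hM n)⟩
    filter_upwards [h1.eventually (hL C hC _ (hcarried Γ' hM') y hy)] with n hn using le_of_lt hn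
  have hIeq : ℓ₁ + ENNReal.ofReal β * ℓ₂ = I :=
    tendsto_nhds_unique (hℓ₁.add (ENNReal.Tendsto.const_mul hℓ₂ (Or.inr ENNReal.ofReal_ne_top)))
      (hlim.mono_left hU)
  refine ⟨Γ', fun Γ'' => ?_⟩
  calc energy L μ₀ ν β Γ' ≤ ℓ₁ + ENNReal.ofReal β * ℓ₂ := by
        unfold energy
        gcongr
        exact hlsc _ hℓ₂
    _ = I := hIeq
    _ ≤ _ := iInf_le _ Γ''

end Minimizer

end TVMatching

end

theorem mainTheorem1 (d : ℕ) (Ω : Set (TVMatching.Euc d)) (hΩ : IsCompact Ω)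
    (μ₀ ν : ProbabilityMeasure (TVMatching.Euc d)) (hμ₀ : μ₀ Ω = 1)
    (L : ProbabilityMeasure (TVMatching.Euc d) → ProbabilityMeasure (TVMatching.Euc d) → ℝ≥0∞)
    (hL : TVMatching.WeakStarLSC (fun μ => L μ ν))
    (β : ℝ) (hβ : 0 < β) :
    -- the flow of every competitor exists, is unique on `[0,1]`, and `ψ_Γ(1)` is continuous
    (∀ Γ : TVMatching.L2Curve Ω,
      TVMatching.IsFlow Γ (TVMatching.flow Γ) ∧
      (∀ ψ : ℝ → TVMatching.Euc d → TVMatching.Euc d, TVMatching.IsFlow Γ ψ →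
        ∀ t ∈ Icc (0 : ℝ) 1, ψ t = TVMatching.flow Γ t) ∧
      Continuous (TVMatching.flow Γ 1)) ∧
    -- the matching problem has a solution
    (∃ Γ : TVMatching.L2Curve Ω, TVMatching.IsMinimizer L μ₀ ν β Γ) ∧
    -- for every solution, the optimal map is a bi-Lipschitz homeomorphism
    (∀ Γ : TVMatching.L2Curve Ω, TVMatching.IsMinimizer L μ₀ ν β Γ →
      TVMatching.IsBiLipschitzHomeo (TVMatching.flow Γ 1)) := by
  have : CompactSpace Ω := isCompact_iff_compactSpace.1 hΩ
  exact ⟨fun Γ => ⟨TVMatching.isFlow_flow Γ, fun ψ hψ t ht => hψ.eq_flow ht,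
    TVMatching.continuous_flow_one Γ⟩, TVMatching.exists_isMinimizer hΩ hμ₀ hL hβ,
    fun Γ _ => TVMatching.isBiLipschitzHomeo_flow Γ⟩
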